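/- Let $1\le k<d$ be integers, let $X,X_1,X_2,\dots$ be i.i.d. random vectors in $\mathbb{R}^d$ with $\mathbb{E}\|X\|_2^2<\infty$, and let $\Sigma=\mathbb{E}[XX^T]$ and $\Sigma_n=\frac1n\sum_{i=1}^nX_iX_i^T$. Let $(u_j)_{j=1}^d$ and, for each $n$, $(u_{n,j})_{j=1}^d$ be orthonormal bases of eigenvectors of $\Sigma$ and of $\Sigma_n$, ordered non-increasingly according to their eigenvalues (ties broken arbitrarily), and let $\lambda_1\ge\dots\ge\lambda_d$ be the eigenvalues of $\Sigma$. Let $U_*=[u_1|\dots|u_k]$, $U_*^\perp=[u_{k+1}|\dots|u_d]$ and $U_n=[u_{n,1}|\dots|u_{n,k}]$. Let $\mathrm{St}(d,k)=\{U\in\mathbb{R}^{d\times k}: U^TU=I_k\}$, and let $\mathrm{Gr}(d,k)$ be its quotient by the relation $U\sim UQ$ for orthogonal $Q\in\mathbb{R}^{k\times k}$, with classes $[U]$. The principal angles $\theta_j([U],[V])\in[0,\pi/2]$ are defined by $\cos\theta_j=s_j$, the $j$-th largest singular value of $U^TV$, and $\operatorname{dist}([U],[V])=\big(\sum_{j=1}^k\theta_j([U],[V])^2\big)^{1/2}$.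 When all principal angles between $[U]$ and $[V]$ are less than $\pi/2$, the lifted Riemannian logarithm is $\operatorname{lift}_U(\operatorname{Log}_{[U]}([V]))=P\arctan(S)Q^T$, where $PSQ^T$ is a singular value decomposition of $(I-UU^T)V(U^TV)^{-1}$, with $P\in\mathbb{R}^{d\times k}$ and $S,Q\in\mathbb{R}^{k\times k}$; otherwise it is given an arbitrary (measurable) value. Let $R([U])=\frac12\mathbb{E}\|X-UU^TX\|_2^2$ be the reconstruction risk. Assume that $[U_n]$ is a random element of $\mathrm{Gr}(d,k)$ for every $n$, that $\lambda_k>\lambda_{k+1}$, and that for all $i,s\in\{1,\dots,d-k\}$ and $j,t\in\{1,\dots,k\}$ the moment $$\Lambda_{ijst}=\mathbb{E}\big[\langle u_{k+i},X\rangle\langle u_j,X\rangle\langle u_{k+s},X\rangle\langle u_t,X\rangle\big]$$ is finite (the product is integrable). Let $\delta_{ij}=\lambda_j-\lambda_{k+i}$. Then, as $n\to\infty$: 1. (Consistency) $\mathbb{P}(\operatorname{dist}([U_n],[U_*])>\varepsilon)\to0$ for every $\varepsilon>0$. 2. (Asymptotic normality) $\sqrt n\,\operatorname{lift}_{U_*}(\operatorname{Log}_{[U_*]}([U_n]))\xrightarrow{d}U_*^\perp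 G$, where $G$ is a mean zero (jointly) Gaussian $(d-k)\times k$ matrix with $\mathbb{E}[G_{ij}G_{st}]=\Lambda_{ijst}/(\delta_{ij}\delta_{st})$. 3. (Excess risk) $n\,\big(R([U_n])-R([U_*])\big)\xrightarrow{d}\frac12\|H\|_F^2$, where $H$ is a mean zero (jointly) Gaussian $(d-k)\times k$ matrix with $\mathbb{E}[H_{ij}H_{st}]=\Lambda_{ijst}/\sqrt{\delta_{ij}\delta_{st}}$. -/

import Mathlib

open MeasureTheory ProbabilityTheory Filter Topology Matrix
open scoped BigOperators

noncomputable section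

namespace PCA

/-! ### Borel structure on matrices -/

/-- Real matrices carry the product σ-algebra of their entries. -/
instance instMeasurableSpaceMatrix (m n : Type*) : MeasurableSpace (Matrix m n ℝ) :=
  inferInstanceAs (MeasurableSpace (m → n → ℝ))

instance instBorelSpaceMatrix (m n : Type*) [Finite m] [Finite n] :
    BorelSpace (Matrix m n ℝ) := by
  have := Fintype.ofFinite m
  have := Fintype.ofFinite n
  exact inferInstanceAs (BorelSpace (m → n → ℝ))

/-! ### Stiefel manifold and Grassmannian -/

/-- `St(d,k)`: the real `d × k` matrices with orthonormal columns. -/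
def Stiefel (d k : ℕ) : Type := {U : Matrix (Fin d) (Fin k) ℝ // Uᵀ * U = 1}

instance (d k : ℕ) : TopologicalSpace (Stiefel d k) :=
  inferInstanceAs (TopologicalSpace {U : Matrix (Fin d) (Fin k) ℝ // Uᵀ * U = 1})

/-- `U ∼ V` iff `V = U Q` for some orthogonal `k × k` matrix `Q`. -/
instance stiefelSetoid (d k : ℕ) : Setoid (Stiefel d k) where
  r U V := ∃ Q ∈ Matrix.orthogonalGroup (Fin k) ℝ, V.1 = U.1 * Q
  iseqv :=
    { refl := fun U => ⟨1, one_mem _, by simp⟩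
      symm := by
        rintro U V ⟨Q, hQ, h⟩
        refine ⟨star Q, Unitary.star_mem hQ, ?_⟩
        rw [h, Matrix.mul_assoc, Unitary.mul_star_self_of_mem hQ, Matrix.mul_one]
      trans := by
        rintro U V W ⟨Q, hQ, h⟩ ⟨Q', hQ', h'⟩
        exact ⟨Q * Q', mul_mem hQ hQ', by rw [h', h, Matrix.mul_assoc]⟩ }

/-- The Grassmannian `Gr(d,k) = St(d,k)/∼`. -/
def Grassmannian (d k : ℕ) : Type := Quotient (stiefelSetoid d k)

/-- The class `[U]`. -/
def Grassmannian.mk {d k : ℕ} (U : Stiefel d k) : Grassmannian d k :=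
  Quotient.mk (stiefelSetoid d k) U

/-- The quotient topology. -/
instance (d k : ℕ) : TopologicalSpace (Grassmannian d k) :=
  inferInstanceAs (TopologicalSpace (Quotient (stiefelSetoid d k)))

instance (d k : ℕ) : MeasurableSpace (Grassmannian d k) := borel _

instance (d k : ℕ) : BorelSpace (Grassmannian d k) := ⟨rfl⟩

/-! ### Principal angles and Riemannian distance -/

/-- The singular values of a real matrix, in non-increasing order, indexed from `0`. -/
def matrixSingularValue {m n : ℕ} (A : Matrix (Fin m) (Fin n) ℝ) (j : ℕ) : ℝ :=
  (Matrix.toEuclideanLin A).singularValues j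

theorem charpoly_toEuclideanLin {n : ℕ} (A : Matrix (Fin n) (Fin n) ℝ) :
    (Matrix.toEuclideanLin A).charpoly = A.charpoly := by
  change (Matrix.toLpLin 2 2 A).charpoly = A.charpoly
  rw [Matrix.toLpLin_eq_toLin]
  exact Matrix.charpoly_toLin A _

theorem adjoint_comp_toEuclideanLin {m n : ℕ} (A : Matrix (Fin m) (Fin n) ℝ) :
    LinearMap.adjoint (Matrix.toEuclideanLin A) ∘ₗ Matrix.toEuclideanLin A
      = Matrix.toEuclideanLin (Aᵀ * A) := by
  rw [← Matrix.toEuclideanLin_conjTranspose_eq_adjoint, Matrix.conjTranspose_eq_transpose_of_trivial]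
  ext x i
  simp [Matrix.toLpLin_apply, Matrix.mulVec_mulVec]

theorem matrixSingularValue_congr {m n m' : ℕ} (A : Matrix (Fin m) (Fin n) ℝ)
    (B : Matrix (Fin m') (Fin n) ℝ) (h : (Aᵀ * A).charpoly = (Bᵀ * B).charpoly) (j : ℕ) :
    matrixSingularValue A j = matrixSingularValue B j := by
  have hn : Module.finrank ℝ (EuclideanSpace ℝ (Fin n)) = n := by simp
  unfold matrixSingularValue
  by_cases hj : j < n
  · rw [LinearMap.singularValues_of_lt _ hn hj, LinearMap.singularValues_of_lt _ hn hj]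
    congr 1
    refine congrFun ((LinearMap.IsSymmetric.eigenvalues_eq_eigenvalues_iff _ hn _ hn).2 ?_) _
    rw [adjoint_comp_toEuclideanLin, adjoint_comp_toEuclideanLin, charpoly_toEuclideanLin,
      charpoly_toEuclideanLin, h]
  · rw [LinearMap.singularValues_of_finrank_le, LinearMap.singularValues_of_finrank_le] <;>
      simpa using hj

theorem matrixSingularValue_orthogonal {k : ℕ} (A Q Q' : Matrix (Fin k) (Fin k) ℝ)
    (hQ : Q ∈ Matrix.orthogonalGroup (Fin k) ℝ) (hQ' : Q' ∈ Matrix.orthogonalGroup (Fin k) ℝ)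
    (j : ℕ) : matrixSingularValue (Qᵀ * A * Q') j = matrixSingularValue A j := by
  apply matrixSingularValue_congr
  have h1 : Q * Qᵀ = 1 := (Matrix.mem_orthogonalGroup_iff (Fin k) ℝ).1 hQ
  have h2 : Q' * Q'ᵀ = 1 := (Matrix.mem_orthogonalGroup_iff (Fin k) ℝ).1 hQ'
  have : (Qᵀ * A * Q')ᵀ * (Qᵀ * A * Q') = Q'ᵀ * (Aᵀ * A * Q') := by
    simp only [Matrix.transpose_mul, Matrix.transpose_transpose, Matrix.mul_assoc]
    rw [← Matrix.mul_assoc Q Qᵀ, h1, Matrix.one_mul]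
  rw [this, Matrix.charpoly_mul_comm, Matrix.mul_assoc, h2, Matrix.mul_one]

/-- The `j`-th principal angle `θ_j ∈ [0, π/2]` (indexed from `0`), given by
`cos θ_j = s_j` with `s_j` the `j`-th largest singular value of `Uᵀ V`. -/
def principalAngle {d k : ℕ} (p q : Grassmannian d k) (j : Fin k) : ℝ :=
  Quotient.liftOn₂ (s₁ := stiefelSetoid d k) (s₂ := stiefelSetoid d k) p q
    (fun U V => Real.arccos (matrixSingularValue (U.1ᵀ * V.1) j))
    (by
      rintro U V U' V' ⟨Q, hQ, h⟩ ⟨Q', hQ', h'⟩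
      have : U'.1ᵀ * V'.1 = Qᵀ * (U.1ᵀ * V.1) * Q' := by
        rw [h, h', Matrix.transpose_mul]
        simp only [Matrix.mul_assoc]
      simp only [this, matrixSingularValue_orthogonal _ _ _ hQ hQ'])

/-- The Riemannian distance on the Grassmannian. -/
def grDist {d k : ℕ} (p q : Grassmannian d k) : ℝ :=
  √(∑ j : Fin k, principalAngle p q j ^ 2)

/-! ### Lifted Riemannian logarithm -/

/-- `M = P diag(s) Qᵀ` is a (thin) singular value decomposition of the `d × k` matrix `M`. -/
structure IsThinSVD {d k : ℕ} (M : Matrix (Fin d) (Fin k) ℝ) (P : Matrix (Fin d) (Fin k) ℝ)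
    (s : Fin k → ℝ) (Q : Matrix (Fin k) (Fin k) ℝ) : Prop where
  left_orthonormal : Pᵀ * P = 1
  nonneg : ∀ j, 0 ≤ s j
  right_orthogonal : Q ∈ Matrix.orthogonalGroup (Fin k) ℝ
  eq_mul : M = P * Matrix.diagonal s * Qᵀ

/-- `Δ = P arctan(S) Qᵀ` for a singular value decomposition
`(I - U Uᵀ) V (Uᵀ V)⁻¹ = P S Qᵀ`, where `V` is a representative of `q`. -/
def IsLiftLog {d k : ℕ} (U : Stiefel d k) (q : Grassmannian d k)
    (Δ : Matrix (Fin d) (Fin k) ℝ) : Prop :=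
  ∃ V : Stiefel d k, Grassmannian.mk V = q ∧
    ∃ (P : Matrix (Fin d) (Fin k) ℝ) (s : Fin k → ℝ) (Q : Matrix (Fin k) (Fin k) ℝ),
      IsThinSVD ((1 - U.1 * U.1ᵀ) * V.1 * (U.1ᵀ * V.1)⁻¹) P s Q ∧
        Δ = P * Matrix.diagonal (fun j => Real.arctan (s j)) * Qᵀ

/-- The logarithm at `p` of `q` is well defined: all principal angles are less than `π/2`. -/
def LogDefined {d k : ℕ} (p q : Grassmannian d k) : Prop :=
  ∀ j, principalAngle p q j < Real.pi / 2

open Classical in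
/-- `lift_U (Log_{[U]} q)`, with the arbitrary value `D` where the logarithm is not defined. -/
def liftLog {d k : ℕ} (U : Stiefel d k) (q : Grassmannian d k)
    (D : Matrix (Fin d) (Fin k) ℝ) : Matrix (Fin d) (Fin k) ℝ :=
  if LogDefined (Grassmannian.mk U) q then Classical.epsilon (IsLiftLog U q) else D

/-! #### The matrix selected in `liftLog` exists and is unique -/

theorem exists_isThinSVD {d k : ℕ} (hkd : k ≤ d) (M : Matrix (Fin d) (Fin k) ℝ) :
    ∃ P s Q, IsThinSVD M P s Q := by
  have hA : (Mᵀ * M).IsHermitian := by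
    have := Matrix.isHermitian_conjTranspose_mul_self M
    rwa [Matrix.conjTranspose_eq_transpose_of_trivial] at this
  have hpos : (Mᵀ * M).PosSemidef := by
    have := Matrix.posSemidef_conjTranspose_mul_self M
    rwa [Matrix.conjTranspose_eq_transpose_of_trivial] at this
  set v := hA.eigenvectorBasis with hv
  set s : Fin k → ℝ := fun j => √(hA.eigenvalues j) with hs
  have hs2 : ∀ j, s j * s j = hA.eigenvalues j := fun j =>
    Real.mul_self_sqrt (hpos.eigenvalues_nonneg j)
  set T := Matrix.toEuclideanLin M with hT
  have hTT : ∀ x y, inner ℝ (T x) (T y) =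
      inner ℝ x (Matrix.toEuclideanLin (Mᵀ * M) y) := by
    intro x y
    rw [← adjoint_comp_toEuclideanLin, LinearMap.comp_apply, LinearMap.adjoint_inner_right]
  have heig : ∀ j, Matrix.toEuclideanLin (Mᵀ * M) (v j) = hA.eigenvalues j • v j := by
    intro j
    have := hA.mulVec_eigenvectorBasis j
    ext a
    simpa [Matrix.toLpLin_apply] using congrFun this a
  have hin : ∀ i j, inner ℝ (T (v i)) (T (v j)) = if i = j then s i * s i else 0 := by
    intro i j
    rw [hTT, heig, inner_smul_right, orthonormal_iff_ite.1 v.orthonormal i j, hs2]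
    split_ifs with h
    · simp [h]
    · simp
  -- extension of the normalized images to an orthonormal basis of `ℝ^d`
  set w : Fin d → EuclideanSpace ℝ (Fin d) := fun a =>
    if h : a.1 < k then (s ⟨a, h⟩)⁻¹ • T (v ⟨a, h⟩) else 0 with hw
  set S : Set (Fin d) := {a | ∃ h : a.1 < k, s ⟨a, h⟩ ≠ 0} with hS
  have hwS : Orthonormal ℝ (S.domRestrict w) := by
    rw [orthonormal_iff_ite]
    rintro ⟨a, ha, ha'⟩ ⟨b, hb, hb'⟩
    have e1 : w a = (s ⟨a, ha⟩)⁻¹ • T (v ⟨a, ha⟩) := dif_pos ha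
    have e2 : w b = (s ⟨b, hb⟩)⁻¹ • T (v ⟨b, hb⟩) := dif_pos hb
    change inner ℝ (w a) (w b) = _
    rw [e1, e2, inner_smul_left, inner_smul_right, hin]
    by_cases h : a = b
    · subst h
      simp only [conj_trivial, if_true]
      field_simp
    · have h' : a.1 ≠ b.1 := fun hh => h (Fin.ext hh)
      simp [h, h']
  obtain ⟨b, hb⟩ := hwS.exists_orthonormalBasis_extension_of_card_eq (by simp)
  have hcol : ∀ j, T (v j) = s j • b (Fin.castLE hkd j) := by
    intro j
    by_cases hj : s j = 0
    · have := hin j j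
      rw [if_pos rfl, hj, mul_zero, inner_self_eq_zero] at this
      rw [this, hj, zero_smul]
    · rw [hb (Fin.castLE hkd j) ⟨j.2, hj⟩]
      simp only [hw, Fin.val_castLE, Fin.is_lt, dif_pos, Fin.eta, smul_smul, mul_inv_cancel₀ hj,
        one_smul]
  have hQ : (Matrix.of fun a j => v j a : Matrix (Fin k) (Fin k) ℝ) ∈
      Matrix.orthogonalGroup (Fin k) ℝ := by
    rw [Matrix.mem_orthogonalGroup_iff']
    ext i j
    have h := (orthonormal_iff_ite.1 v.orthonormal) i j
    simp only [PiLp.inner_apply, RCLike.inner_apply, conj_trivial] at h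
    rw [Matrix.one_apply, ← h]
    simp only [Matrix.mul_apply, Matrix.transpose_apply, Matrix.of_apply]
    exact Finset.sum_congr rfl fun a _ => mul_comm _ _
  refine ⟨Matrix.of fun a j => b (Fin.castLE hkd j) a, s, Matrix.of fun a j => v j a, ?_,
    fun j => Real.sqrt_nonneg _, hQ, ?_⟩
  · ext i j
    have h := (orthonormal_iff_ite.1 b.orthonormal) (Fin.castLE hkd i) (Fin.castLE hkd j)
    simp only [PiLp.inner_apply, RCLike.inner_apply, conj_trivial, Fin.castLE_inj] at h
    rw [Matrix.one_apply, ← h]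
    simp only [Matrix.mul_apply, Matrix.transpose_apply, Matrix.of_apply]
    exact Finset.sum_congr rfl fun a _ => mul_comm _ _
  · have hMQ : M * (Matrix.of fun a j => v j a) =
        (Matrix.of fun a j => b (Fin.castLE hkd j) a) * Matrix.diagonal s := by
      ext a j
      have h := congrArg (fun z : EuclideanSpace ℝ (Fin d) => z a) (hcol j)
      simp only [hT, Matrix.toLpLin_apply, PiLp.smul_apply, smul_eq_mul, Matrix.mulVec,
        dotProduct] at h
      rw [Matrix.mul_diagonal, Matrix.of_apply, mul_comm, ← h, Matrix.mul_apply]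
      rfl
    rw [← hMQ, Matrix.mul_assoc, (Matrix.mem_orthogonalGroup_iff (Fin k) ℝ).1 hQ, Matrix.mul_one]

theorem aeval_orthogonal_conj {k : ℕ} {Q : Matrix (Fin k) (Fin k) ℝ} (h1 : Q * Qᵀ = 1)
    (h2 : Qᵀ * Q = 1) (t : Fin k → ℝ) (p : Polynomial ℝ) :
    Polynomial.aeval (Q * Matrix.diagonal t * Qᵀ) p
      = Q * Matrix.diagonal (fun j => p.eval (t j)) * Qᵀ := by
  induction p using Polynomial.induction_on with
  | C a =>
    simp only [Polynomial.aeval_C, Polynomial.eval_C, Algebra.algebraMap_eq_smul_one]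
    rw [← Matrix.smul_one_eq_diagonal, Matrix.mul_smul, Matrix.mul_one, Matrix.smul_mul, h1]
  | add p q hp hq =>
    simp only [map_add, hp, hq, Polynomial.eval_add]
    rw [← Matrix.add_mul, ← Matrix.mul_add, Matrix.diagonal_add]
  | monomial n a ih =>
    rw [pow_succ, ← mul_assoc, map_mul, ih, Polynomial.aeval_X]
    have : Q * Matrix.diagonal (fun j => Polynomial.eval (t j) (Polynomial.C a * Polynomial.X ^ n))
        * Qᵀ * (Q * Matrix.diagonal t * Qᵀ) =
        Q * (Matrix.diagonal (fun j => Polynomial.eval (t j) (Polynomial.C a * Polynomial.X ^ n))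
          * ((Qᵀ * Q) * Matrix.diagonal t)) * Qᵀ := by
      simp only [Matrix.mul_assoc]
    rw [this, h2, Matrix.one_mul, Matrix.diagonal_mul_diagonal]
    simp only [Polynomial.eval_mul, Polynomial.eval_X]

theorem IsThinSVD.mul_aeval {d k : ℕ} {M P : Matrix (Fin d) (Fin k) ℝ}
    {s : Fin k → ℝ} {Q : Matrix (Fin k) (Fin k) ℝ} (h : IsThinSVD M P s Q) (p : Polynomial ℝ) :
    M * Polynomial.aeval (Mᵀ * M) p
      = P * Matrix.diagonal (fun j => s j * p.eval (s j * s j)) * Qᵀ := by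
  have h1 : Q * Qᵀ = 1 := (Matrix.mem_orthogonalGroup_iff (Fin k) ℝ).1 h.right_orthogonal
  have h2 : Qᵀ * Q = 1 := (Matrix.mem_orthogonalGroup_iff' (Fin k) ℝ).1 h.right_orthogonal
  have hMM : Mᵀ * M = Q * Matrix.diagonal (fun j => s j * s j) * Qᵀ := by
    have : Mᵀ * M = Q * (Matrix.diagonal s * ((Pᵀ * P) * Matrix.diagonal s)) * Qᵀ := by
      rw [h.eq_mul]
      simp only [Matrix.transpose_mul, Matrix.transpose_transpose, Matrix.diagonal_transpose,
        Matrix.mul_assoc]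
    rw [this, h.left_orthonormal, Matrix.one_mul, Matrix.diagonal_mul_diagonal]
  rw [hMM, aeval_orthogonal_conj h1 h2]
  have : M * (Q * Matrix.diagonal (fun j => p.eval (s j * s j)) * Qᵀ) =
      P * (Matrix.diagonal s * ((Qᵀ * Q) * Matrix.diagonal (fun j => p.eval (s j * s j)))) * Qᵀ := by
    rw [h.eq_mul]
    simp only [Matrix.mul_assoc]
  rw [this, h2, Matrix.one_mul, Matrix.diagonal_mul_diagonal]

theorem IsThinSVD.arctan_unique {d k : ℕ} {M P P' : Matrix (Fin d) (Fin k) ℝ}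
    {s s' : Fin k → ℝ} {Q Q' : Matrix (Fin k) (Fin k) ℝ}
    (h : IsThinSVD M P s Q) (h' : IsThinSVD M P' s' Q') :
    P * Matrix.diagonal (fun j => Real.arctan (s j)) * Qᵀ
      = P' * Matrix.diagonal (fun j => Real.arctan (s' j)) * Q'ᵀ := by
  classical
  set N : Finset ℝ := Finset.univ.image (fun j => s j * s j) ∪
    Finset.univ.image (fun j => s' j * s' j) with hN
  set p : Polynomial ℝ := Lagrange.interpolate N id (fun x => Real.arctan (√x) / √x) with hp
  have key : ∀ x : ℝ, 0 ≤ x → x * x ∈ N → x * p.eval (x * x) = Real.arctan x := by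
    intro x hx hxN
    have := Lagrange.eval_interpolate_at_node (s := N) (v := id)
      (fun x => Real.arctan (√x) / √x) (Function.injective_id.injOn) hxN
    simp only [id_eq] at this
    rw [hp, this, Real.sqrt_mul_self hx]
    by_cases h0 : x = 0
    · simp [h0]
    · field_simp
  have e := h.mul_aeval p
  rw [h'.mul_aeval p] at e
  have e1 : (fun j => s j * p.eval (s j * s j)) = fun j => Real.arctan (s j) := by
    funext j
    exact key _ (h.nonneg j) (by simp [hN])
  have e2 : (fun j => s' j * p.eval (s' j * s' j)) = fun j => Real.arctan (s' j) := by
    funext j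
    exact key _ (h'.nonneg j) (by simp [hN])
  rw [e1, e2] at e
  exact e.symm

theorem existsUnique_isLiftLog {d k : ℕ} (hkd : k ≤ d) (U : Stiefel d k)
    (q : Grassmannian d k) : ∃! Δ, IsLiftLog U q Δ := by
  obtain ⟨V, hV⟩ : ∃ V : Stiefel d k, Grassmannian.mk V = q := Quotient.exists_rep q
  obtain ⟨P, s, Q, h⟩ := exists_isThinSVD hkd ((1 - U.1 * U.1ᵀ) * V.1 * (U.1ᵀ * V.1)⁻¹)
  refine ⟨_, ⟨V, hV, P, s, Q, h, rfl⟩, ?_⟩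
  rintro Δ ⟨V', hV', P', s', Q', h', rfl⟩
  obtain ⟨O, hO, hVO⟩ : ∃ O ∈ Matrix.orthogonalGroup (Fin k) ℝ, V'.1 = V.1 * O :=
    Quotient.exact (s := stiefelSetoid d k) (hV.trans hV'.symm)
  have hO1 : O * Oᵀ = 1 := (Matrix.mem_orthogonalGroup_iff (Fin k) ℝ).1 hO
  have hOinv : O * O⁻¹ = 1 := by rw [Matrix.inv_eq_right_inv hO1, hO1]
  have : (1 - U.1 * U.1ᵀ) * V'.1 * (U.1ᵀ * V'.1)⁻¹
      = (1 - U.1 * U.1ᵀ) * V.1 * (U.1ᵀ * V.1)⁻¹ := by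
    rw [hVO, ← Matrix.mul_assoc U.1ᵀ, Matrix.mul_inv_rev]
    have : (1 - U.1 * U.1ᵀ) * (V.1 * O) * (O⁻¹ * (U.1ᵀ * V.1)⁻¹)
        = (1 - U.1 * U.1ᵀ) * V.1 * ((O * O⁻¹) * (U.1ᵀ * V.1)⁻¹) := by
      simp only [Matrix.mul_assoc]
    rw [this, hOinv, Matrix.one_mul]
  rw [this] at h'
  exact h'.arctan_unique h

theorem liftLog_spec {d k : ℕ} (hkd : k ≤ d) (U : Stiefel d k) (q : Grassmannian d k)
    (D : Matrix (Fin d) (Fin k) ℝ) (h : LogDefined (Grassmannian.mk U) q) :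
    IsLiftLog U q (liftLog U q D) := by
  rw [liftLog, if_pos h]
  exact Classical.epsilon_spec (existsUnique_isLiftLog hkd U q).exists

/-! ### Covariance matrices, eigenbases, reconstruction risk -/

/-- The population second-moment matrix `Σ = E[X Xᵀ]` for `X` with law `μ`. -/
def populationCov {d : ℕ} (μ : Measure (EuclideanSpace ℝ (Fin d))) :
    Matrix (Fin d) (Fin d) ℝ :=
  Matrix.of fun a b => ∫ x, x a * x b ∂μ

/-- The empirical second-moment matrix `Σ_n = n⁻¹ ∑ X_i X_iᵀ` of the first `n` samples. -/
def empiricalCov {d : ℕ} (x : ℕ → EuclideanSpace ℝ (Fin d)) (n : ℕ) :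
    Matrix (Fin d) (Fin d) ℝ :=
  (n : ℝ)⁻¹ • ∑ i ∈ Finset.range n, Matrix.of fun a b => x i a * x i b

/-- `u` is an orthonormal basis of eigenvectors of `A`, with corresponding eigenvalues `lam`
in non-increasing order. -/
structure IsOrderedEigenbasis {d : ℕ} (A : Matrix (Fin d) (Fin d) ℝ)
    (u : OrthonormalBasis (Fin d) ℝ (EuclideanSpace ℝ (Fin d))) (lam : Fin d → ℝ) : Prop where
  antitone : Antitone lam
  apply_eq : ∀ j, Matrix.toEuclideanLin A (u j) = lam j • u j

/-- The position `j` among `1, …, d`, for `j ∈ {1, …, k}` (both indexed from `0`). -/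
def headIdx {d k : ℕ} (hkd : k ≤ d) : Fin k ↪ Fin d := Fin.castLEEmb hkd

/-- The position `k + i` among `1, …, d`, for `i ∈ {1, …, d - k}` (both indexed from `0`). -/
def tailIdx {d k : ℕ} (hkd : k ≤ d) : Fin (d - k) ↪ Fin d where
  toFun i := ⟨k + i, by omega⟩
  inj' i j h := by
    simp only [Fin.mk.injEq] at h
    exact Fin.ext (by omega)

/-- The matrix whose columns are the basis vectors `u (e j)`. -/
def frame {d m : ℕ} (u : OrthonormalBasis (Fin d) ℝ (EuclideanSpace ℝ (Fin d)))
    (e : Fin m ↪ Fin d) : Stiefel d m :=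
  ⟨Matrix.of fun a j => u (e j) a, by
    ext i j
    have h := (orthonormal_iff_ite.1 u.orthonormal) (e i) (e j)
    simp only [PiLp.inner_apply, RCLike.inner_apply, conj_trivial, e.injective.eq_iff] at h
    rw [Matrix.one_apply, ← h]
    simp only [Matrix.mul_apply, Matrix.transpose_apply, Matrix.of_apply]
    exact Finset.sum_congr rfl fun a _ => mul_comm _ _⟩

/-- The `d × k` matrix of the leading `k` vectors of the basis. -/
def leadingFrame {d k : ℕ} (hkd : k ≤ d)
    (u : OrthonormalBasis (Fin d) ℝ (EuclideanSpace ℝ (Fin d))) : Stiefel d k :=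
  frame u (headIdx hkd)

/-- The `d × (d - k)` matrix of the trailing `d - k` vectors of the basis. -/
def trailingFrame {d k : ℕ} (hkd : k ≤ d)
    (u : OrthonormalBasis (Fin d) ℝ (EuclideanSpace ℝ (Fin d))) : Stiefel d (d - k) :=
  frame u (tailIdx hkd)

/-- The population reconstruction risk `R([U]) = ½ E ‖X - U Uᵀ X‖²` for `X` with law `μ`. -/
def risk {d k : ℕ} (μ : Measure (EuclideanSpace ℝ (Fin d))) (p : Grassmannian d k) : ℝ :=
  Quotient.liftOn (s := stiefelSetoid d k) p
    (fun U => (1 / 2 : ℝ) * ∫ x, ‖x - Matrix.toEuclideanLin (U.1 * U.1ᵀ) x‖ ^ 2 ∂μ)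
    (by
      rintro U V ⟨Q, hQ, h⟩
      have h1 : Q * Qᵀ = 1 := (Matrix.mem_orthogonalGroup_iff (Fin k) ℝ).1 hQ
      have : V.1 * V.1ᵀ = U.1 * U.1ᵀ := by
        rw [h, Matrix.transpose_mul, Matrix.mul_assoc, ← Matrix.mul_assoc Q, h1, Matrix.one_mul]
      simp only [this])

/-! ### Fourth moments, gaps, Gaussian matrices -/

/-- The variable `⟨u_{k+i}, x⟩ ⟨u_j, x⟩ ⟨u_{k+s}, x⟩ ⟨u_t, x⟩`. -/
def crossProduct {d k : ℕ} (hkd : k ≤ d)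
    (u : OrthonormalBasis (Fin d) ℝ (EuclideanSpace ℝ (Fin d)))
    (i : Fin (d - k)) (j : Fin k) (s : Fin (d - k)) (t : Fin k)
    (x : EuclideanSpace ℝ (Fin d)) : ℝ :=
  inner ℝ (u (tailIdx hkd i)) x * inner ℝ (u (headIdx hkd j)) x *
    inner ℝ (u (tailIdx hkd s)) x * inner ℝ (u (headIdx hkd t)) x

/-- `Λ_{ijst} = E[⟨u_{k+i}, X⟩ ⟨u_j, X⟩ ⟨u_{k+s}, X⟩ ⟨u_t, X⟩]` for `X` with law `μ`. -/
def crossMoment {d k : ℕ} (hkd : k ≤ d) (μ : Measure (EuclideanSpace ℝ (Fin d)))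
    (u : OrthonormalBasis (Fin d) ℝ (EuclideanSpace ℝ (Fin d)))
    (i : Fin (d - k)) (j : Fin k) (s : Fin (d - k)) (t : Fin k) : ℝ :=
  ∫ x, crossProduct hkd u i j s t x ∂μ

/-- `δ_{ij} = λ_j - λ_{k+i}`. -/
def gap {d k : ℕ} (hkd : k ≤ d) (lam : Fin d → ℝ) (i : Fin (d - k)) (j : Fin k) : ℝ :=
  lam (headIdx hkd j) - lam (tailIdx hkd i)

/-- `ν` is the law of a mean zero (jointly) Gaussian random matrix `G` with
`E[G_{ij} G_{st}] = C i j s t`. -/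
structure IsCenteredGaussianMatrix {m n : ℕ} (ν : Measure (Matrix (Fin m) (Fin n) ℝ))
    (C : Fin m → Fin n → Fin m → Fin n → ℝ) : Prop where
  isGaussian : IsGaussian ν
  mean_eq_zero : ∀ i j, ∫ G, G i j ∂ν = 0
  moment_eq : ∀ i j s t, ∫ G, G i j * G s t ∂ν = C i j s t

/-- The squared Frobenius norm. -/
def frobeniusSq {m n : ℕ} (A : Matrix (Fin m) (Fin n) ℝ) : ℝ := ∑ i, ∑ j, A i j ^ 2

end PCA

end

noncomputable section

namespace PCA

open scoped Matrix.Norms.Frobenius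

/-! ### Frobenius norm, traces and matrices with orthonormal columns. -/

section Frobenius

variable {m n l κ : Type*} [Fintype m] [Fintype n] [Fintype l] [Fintype κ]

/-! The theorem is a deterministic expansion at a matrix with an eigengap, combined with the law of
large numbers, the central limit theorem and Slutsky's argument. Write `A` for Σ, `B` for Σ_n, `U`
and `N` for the leading and trailing frames of `A`, `V` for the leading frame of `B`, and `C = Nᵀ B
U`. Since `Nᵀ A U = 0`, the block `C` is of the order of `B - A`.

A trace comparison in the manner of Ky Fan gives gap · ‖Nᵀ V‖² ≤ 2k ‖B - A‖
(`IsSplit.perturbation`). All principal angles are therefore small once `B` is close to `A`, and the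
law of large numbers yields consistency.

For `B` near `A` the overlap `Uᵀ V` is invertible, and the span of `V` is the graph of `T = Nᵀ V (Uᵀ
V)⁻¹` over the span of `U`. Invariance of this span under `B` is a Riccati equation for `T`
(`IsSplit.riccati`). Its linearisation has the solution `C i j / δ i j`, with an error of order ‖C‖
‖B - A‖. The lifted logarithm is `N T` with arctan applied to the singular values, which costs only
‖T‖². The excess risk is half of ∑ δ T² up to order ‖T‖⁴, hence half of ∑ C²/δ up to order ‖C‖² ‖B -
A‖ (`IsSplit.exists_expansion`, `exists_liftLog_risk_expansion`).

Finally √n · `C` is a normalised sum of the i.i.d. vectors with entries ⟨u_{k+i}, X⟩⟨u_j, X⟩. These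
are centred because `A` is diagonal in the basis `u`, and the cross moments are their second
moments, so the central limit theorem applies (`tendstoInDistribution_scaledSum`). After scaling,
the errors are powers of the tight ‖√n C‖ times ‖B - A‖, which tends to zero in probability. No rate
for ‖B - A‖ is used, so no fourth moments other than the cross moments are required. -/

theorem frobenius_norm_sq (A : Matrix m n ℝ) : ‖A‖ ^ 2 = ∑ i, ∑ j, A i j ^ 2 := by
  rw [Matrix.frobenius_norm_def, ← Real.sqrt_eq_rpow, Real.sq_sqrt]
  · simp
  · positivity

theorem frobenius_norm_sq_eq_trace (A : Matrix m n ℝ) : ‖A‖ ^ 2 = (Aᵀ * A).trace := by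
  rw [frobenius_norm_sq, Finset.sum_comm]
  simp [Matrix.trace, Matrix.mul_apply, sq]

theorem abs_sum_mul_le (A B : Matrix m n ℝ) : |∑ i, ∑ j, A i j * B i j| ≤ ‖A‖ * ‖B‖ := by
  apply abs_le_of_sq_le_sq _ (by positivity)
  rw [mul_pow, frobenius_norm_sq, frobenius_norm_sq]
  simp_rw [← Fintype.sum_prod_type']
  exact Finset.sum_mul_sq_le_sq_mul_sq _ _ _

theorem abs_trace_mul_le (A : Matrix m n ℝ) (B : Matrix n m ℝ) :
    |(A * B).trace| ≤ ‖A‖ * ‖B‖ := by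
  have h := abs_sum_mul_le A Bᵀ
  rw [Matrix.frobenius_norm_transpose] at h
  simpa [Matrix.trace, Matrix.mul_apply] using h

theorem norm_isometry_mul [DecidableEq n] {U : Matrix m n ℝ} (hU : Uᵀ * U = 1)
    (A : Matrix n l ℝ) : ‖U * A‖ = ‖A‖ := by
  have : ‖U * A‖ ^ 2 = ‖A‖ ^ 2 := by
    rw [frobenius_norm_sq_eq_trace, frobenius_norm_sq_eq_trace, Matrix.transpose_mul,
      Matrix.mul_assoc, ← Matrix.mul_assoc Uᵀ, hU, Matrix.one_mul]
  exact (sq_eq_sq₀ (norm_nonneg _) (norm_nonneg _)).1 this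

theorem norm_sq_isometry [DecidableEq n] {U : Matrix m n ℝ} (hU : Uᵀ * U = 1) :
    ‖U‖ ^ 2 = Fintype.card n := by
  rw [frobenius_norm_sq_eq_trace, hU, Matrix.trace_one]

end Frobenius

/-! ### Orthogonal splittings, trace comparison and the spectral perturbation bound. -/

/-- `[U | N]` is an orthogonal matrix. -/
structure IsSplit {m κ l : Type*} [Fintype m] [Fintype κ] [Fintype l] [DecidableEq m]
    [DecidableEq κ] [DecidableEq l] (U : Matrix m κ ℝ) (N : Matrix m l ℝ) : Prop where
  left : Uᵀ * U = 1
  right : Nᵀ * N = 1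
  add : U * Uᵀ + N * Nᵀ = 1

namespace IsSplit

variable {m κ l : Type*} [Fintype m] [Fintype κ] [Fintype l] [DecidableEq m]
    [DecidableEq κ] [DecidableEq l] {U V : Matrix m κ ℝ} {N : Matrix m l ℝ}

theorem cross (h : IsSplit U N) : Uᵀ * N = 0 := by
  have e : Uᵀ * (U * Uᵀ + N * Nᵀ) * N = Uᵀ * N + Uᵀ * N := by
    rw [Matrix.mul_add, Matrix.add_mul, ← Matrix.mul_assoc, h.left, Matrix.one_mul,
      Matrix.mul_assoc, Matrix.mul_assoc N, h.right, Matrix.mul_one]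
  rw [h.add, Matrix.mul_one] at e
  simpa using e

theorem cross' (h : IsSplit U N) : Nᵀ * U = 0 := by
  have := congrArg Matrix.transpose h.cross
  simpa [Matrix.transpose_mul] using this

theorem gram_add {n : Type*} [Fintype n] (h : IsSplit U N) (A : Matrix m n ℝ) :
    (Uᵀ * A)ᵀ * (Uᵀ * A) + (Nᵀ * A)ᵀ * (Nᵀ * A) = Aᵀ * A := by
  have : (Uᵀ * A)ᵀ * (Uᵀ * A) + (Nᵀ * A)ᵀ * (Nᵀ * A) = Aᵀ * (U * Uᵀ + N * Nᵀ) * A := by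
    simp only [Matrix.transpose_mul, Matrix.transpose_transpose, Matrix.mul_add, Matrix.add_mul,
      Matrix.mul_assoc]
  rw [this, h.add, Matrix.mul_one]

theorem norm_sq_add {n : Type*} [Fintype n] (h : IsSplit U N) (A : Matrix m n ℝ) :
    ‖Uᵀ * A‖ ^ 2 + ‖Nᵀ * A‖ ^ 2 = ‖A‖ ^ 2 := by
  simp only [frobenius_norm_sq_eq_trace]
  rw [← Matrix.trace_add, h.gram_add]

/-- The rows of `Uᵀ V` have norm at most one if `U` and `V` have orthonormal columns. -/
theorem _root_.PCA.sum_sq_row_le_one (hU : Uᵀ * U = 1) (hV : Vᵀ * V = 1) (j : κ) :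
    ∑ c, (Uᵀ * V) j c ^ 2 ≤ 1 := by
  -- The right-hand side is a Gram matrix, so its diagonal entries are nonnegative.
  have e : ((1 - V * Vᵀ) * U)ᵀ * ((1 - V * Vᵀ) * U) = 1 - (Uᵀ * V) * (Uᵀ * V)ᵀ := by
    have e1 : (1 - V * Vᵀ) * (1 - V * Vᵀ) = 1 - V * Vᵀ := by
      have : V * Vᵀ * (V * Vᵀ) = V * Vᵀ := by
        rw [Matrix.mul_assoc, ← Matrix.mul_assoc Vᵀ, hV, Matrix.one_mul]
      rw [Matrix.sub_mul, Matrix.one_mul, Matrix.mul_sub, Matrix.mul_one, this, sub_self, sub_zero]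
    have e2 : (1 - V * Vᵀ)ᵀ = 1 - V * Vᵀ := by simp [Matrix.transpose_mul]
    rw [Matrix.transpose_mul, e2, Matrix.mul_assoc, ← Matrix.mul_assoc (1 - V * Vᵀ), e1,
      Matrix.sub_mul, Matrix.mul_sub, Matrix.one_mul, hU]
    simp only [Matrix.transpose_mul, Matrix.transpose_transpose, Matrix.mul_assoc]
  have h := congrFun (congrFun e j) j
  rw [Matrix.mul_apply, Matrix.sub_apply, Matrix.one_apply_eq, Matrix.mul_apply] at h
  have h0 : 0 ≤ ∑ i, ((1 - V * Vᵀ) * U)ᵀ j i * ((1 - V * Vᵀ) * U : Matrix m κ ℝ) i j :=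
    Finset.sum_nonneg fun i _ => mul_self_nonneg _
  have h1 : ∑ c, (Uᵀ * V) j c ^ 2 = ∑ c, (Uᵀ * V) j c * (Uᵀ * V)ᵀ c j :=
    Finset.sum_congr rfl fun c _ => by rw [sq]; rfl
  rw [h1]; linarith

theorem eq_of_mul {A : Matrix m m ℝ} {a : κ → ℝ} {b : l → ℝ} (h : IsSplit U N)
    (hA : A * U = U * diagonal a) (hA' : A * N = N * diagonal b) :
    A = U * diagonal a * Uᵀ + N * diagonal b * Nᵀ := by
  rw [← hA, ← hA', Matrix.mul_assoc, Matrix.mul_assoc, ← Matrix.mul_add, h.add, Matrix.mul_one]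

/-- An orthonormal eigenbasis with real eigenvalues already forces symmetry, so no separate symmetry
hypothesis has to be carried along. -/
theorem isSymm_of_mul {A : Matrix m m ℝ} {a : κ → ℝ} {b : l → ℝ} (h : IsSplit U N)
    (hA : A * U = U * diagonal a) (hA' : A * N = N * diagonal b) : Aᵀ = A := by
  rw [h.eq_of_mul hA hA']
  simp [Matrix.transpose_mul, Matrix.mul_assoc]

theorem _root_.PCA.trace_diagonal_conj {n : Type*} [Fintype n] (a : κ → ℝ) (W : Matrix κ n ℝ) :
    (Wᵀ * diagonal a * W).trace = ∑ j, a j * ∑ c, W j c ^ 2 := by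
  rw [Matrix.mul_assoc, Matrix.trace_mul_comm]
  simp only [Matrix.trace, Matrix.diag, Matrix.mul_apply, Finset.mul_sum,
    Matrix.transpose_apply]
  simp [Matrix.diagonal_apply, sq, mul_assoc]

theorem trace_conj {n : Type*} [Fintype n] {A : Matrix m m ℝ} {a : κ → ℝ} {b : l → ℝ}
    (h : IsSplit U N) (hA : A * U = U * diagonal a) (hA' : A * N = N * diagonal b)
    (X : Matrix m n ℝ) : (Xᵀ * A * X).trace =
      ∑ j, a j * ∑ c, (Uᵀ * X) j c ^ 2 + ∑ i, b i * ∑ c, (Nᵀ * X) i c ^ 2 := by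
  rw [← trace_diagonal_conj, ← trace_diagonal_conj, ← Matrix.trace_add, h.eq_of_mul hA hA']
  simp only [Matrix.transpose_mul, Matrix.transpose_transpose, Matrix.mul_add, Matrix.add_mul,
    Matrix.mul_assoc]

theorem trace_self {A : Matrix m m ℝ} {a : κ → ℝ}
    (h : IsSplit U N) (hA : A * U = U * diagonal a) : (Uᵀ * A * U).trace = ∑ j, a j := by
  rw [Matrix.mul_assoc, hA, ← Matrix.mul_assoc, h.left, Matrix.one_mul, Matrix.trace_diagonal]

/-- In the eigenbasis the difference of traces is ∑ a_j (1 - row_j) - ∑ b_i row'_i, where the rows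
are the squared row norms of `Uᵀ V` and `Nᵀ V`. All weights are nonnegative, so `a` and `b` may be
replaced by their bounds, and by Pythagoras both total weights equal ‖Nᵀ V‖². -/
theorem trace_gap {A : Matrix m m ℝ} {a : κ → ℝ} {b : l → ℝ} {α β : ℝ}
    (h : IsSplit U N) (hA : A * U = U * diagonal a) (hA' : A * N = N * diagonal b)
    (ha : ∀ j, α ≤ a j) (hb : ∀ i, b i ≤ β) (hV : Vᵀ * V = 1) :
    (α - β) * ‖Nᵀ * V‖ ^ 2 ≤ (Uᵀ * A * U).trace - (Vᵀ * A * V).trace := by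
  rw [h.trace_conj hA hA' V, h.trace_self hA]
  have e1 := h.norm_sq_add V
  rw [norm_sq_isometry hV] at e1
  have e2 : ‖Uᵀ * V‖ ^ 2 = ∑ j, ∑ c, (Uᵀ * V) j c ^ 2 := frobenius_norm_sq _
  have e3 : ‖Nᵀ * V‖ ^ 2 = ∑ j, ∑ c, (Nᵀ * V) j c ^ 2 := frobenius_norm_sq _
  have h1 : ∑ j, α * (1 - ∑ c, (Uᵀ * V) j c ^ 2) ≤ ∑ j, a j * (1 - ∑ c, (Uᵀ * V) j c ^ 2) :=
    Finset.sum_le_sum fun j _ => mul_le_mul_of_nonneg_right (ha j)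
      (sub_nonneg.2 (sum_sq_row_le_one h.left hV j))
  have h2 : ∑ i, b i * ∑ c, (Nᵀ * V) i c ^ 2 ≤ ∑ i, β * ∑ c, (Nᵀ * V) i c ^ 2 :=
    Finset.sum_le_sum fun j _ => mul_le_mul_of_nonneg_right (hb j)
      (Finset.sum_nonneg fun _ _ => sq_nonneg _)
  rw [← Finset.mul_sum, Finset.sum_sub_distrib, ← e2] at h1
  rw [← Finset.mul_sum, ← e3] at h2
  simp only [mul_sub, mul_one, Finset.sum_sub_distrib] at h1
  simp only [Finset.sum_const, Finset.card_univ, nsmul_eq_mul, mul_one] at h1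
  have e4 : α * ‖Nᵀ * V‖ ^ 2 = α * Fintype.card κ - α * ‖Uᵀ * V‖ ^ 2 := by
    rw [← e1]; ring
  linarith

/-- A spectral perturbation bound: a leading frame `V` of `B` is almost orthogonal to the trailing
frame `N` of `A` if `B` is close to `A`. -/
theorem perturbation {A B : Matrix m m ℝ} {a a' : κ → ℝ} {b b' : l → ℝ} {α β α' : ℝ}
    {N' : Matrix m l ℝ}
    (h : IsSplit U N) (hA : A * U = U * diagonal a) (hA' : A * N = N * diagonal b)
    (ha : ∀ j, α ≤ a j) (hb : ∀ i, b i ≤ β)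
    (h' : IsSplit V N') (hB : B * V = V * diagonal a') (hB' : B * N' = N' * diagonal b')
    (ha' : ∀ j, α' ≤ a' j) (hb' : ∀ i, b' i ≤ α') :
    (α - β) * ‖Nᵀ * V‖ ^ 2 ≤ 2 * Fintype.card κ * ‖B - A‖ := by
  have h1 := h.trace_gap hA hA' ha hb h'.left
  -- With both thresholds equal to `α'` this only says that `V` maximises the trace of `B`; no gap
  -- in the spectrum of `B` is needed.
  have h2 := h'.trace_gap hB hB' ha' hb' h.left
  rw [sub_self, zero_mul] at h2
  have key : ∀ X : Matrix m κ ℝ, Xᵀ * X = 1 →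
      |(Xᵀ * B * X).trace - (Xᵀ * A * X).trace| ≤ Fintype.card κ * ‖B - A‖ := by
    intro X hX
    rw [← Matrix.trace_sub, ← Matrix.sub_mul, ← Matrix.mul_sub, ← norm_sq_isometry hX]
    refine (abs_trace_mul_le _ _).trans ?_
    have := Matrix.frobenius_norm_mul Xᵀ (B - A)
    rw [Matrix.frobenius_norm_transpose] at this
    nlinarith [norm_nonneg X]
  have k1 := abs_le.1 (key U h.left)
  have k2 := abs_le.1 (key V h'.left)
  linarith

end IsSplit

theorem mul_norm_le_of_entries {κ l : Type*} [Fintype κ] [Fintype l] {X Y : Matrix l κ ℝ}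
    {g : ℝ} (hg : 0 ≤ g)
    (h : ∀ i j, g * |X i j| ≤ |Y i j|) : g * ‖X‖ ≤ ‖Y‖ := by
  refine (sq_le_sq₀ (by positivity) (norm_nonneg _)).1 ?_
  rw [mul_pow, frobenius_norm_sq, frobenius_norm_sq, Finset.mul_sum]
  refine Finset.sum_le_sum fun i _ => ?_
  rw [Finset.mul_sum]
  refine Finset.sum_le_sum fun j _ => ?_
  have := pow_le_pow_left₀ (by positivity) (h i j) 2
  rwa [mul_pow, sq_abs, sq_abs] at this

/-! ### The leading subspace as a graph, its Riccati equation and the excess trace. -/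

namespace IsSplit

variable {m κ l : Type*} [Fintype m] [Fintype κ] [Fintype l] [DecidableEq m]
    [DecidableEq κ] [DecidableEq l] {U V : Matrix m κ ℝ} {N : Matrix m l ℝ}

/-- Pythagoras for `V * X`, which has the norm of `X` and whose component along `N` is at most ‖Nᵀ
V‖ ‖X‖. This quantitative injectivity of the overlap gives its invertibility, the bound on its
inverse and the bound on the principal angles. -/
theorem norm_sq_overlap_mul_ge {n : Type*} [Fintype n] (h : IsSplit U N) (hV : Vᵀ * V = 1)
    (X : Matrix κ n ℝ) : (1 - ‖Nᵀ * V‖ ^ 2) * ‖X‖ ^ 2 ≤ ‖Uᵀ * V * X‖ ^ 2 := by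
  have e := h.norm_sq_add (V * X)
  rw [norm_isometry_mul hV, ← Matrix.mul_assoc, ← Matrix.mul_assoc] at e
  have := pow_le_pow_left₀ (norm_nonneg _) (Matrix.frobenius_norm_mul (Nᵀ * V) X) 2
  rw [mul_pow] at this
  linarith

theorem isUnit_overlap (h : IsSplit U N) (hV : Vᵀ * V = 1) (hZ : ‖Nᵀ * V‖ ^ 2 < 1) :
    IsUnit (Uᵀ * V).det := by
  rw [isUnit_iff_ne_zero]
  intro h0
  obtain ⟨v, hv, hv0⟩ := Matrix.exists_mulVec_eq_zero_iff.2 h0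
  have e := h.norm_sq_overlap_mul_ge hV (Matrix.replicateCol Unit v)
  rw [← Matrix.replicateCol_mulVec, hv0] at e
  have e0 : Matrix.replicateCol Unit (0 : κ → ℝ) = 0 := by ext; simp
  rw [e0, norm_zero] at e
  have : 0 < ‖Matrix.replicateCol Unit v‖ := norm_pos_iff.2 fun h1 => hv (by
    ext i; exact congrFun (congrFun h1 i) ())
  have := mul_pos (sub_pos.2 hZ) (pow_pos this 2)
  rw [zero_pow two_ne_zero] at e
  linarith

theorem norm_sq_inv_overlap_le (h : IsSplit U N) (hV : Vᵀ * V = 1) (hZ : ‖Nᵀ * V‖ ^ 2 < 1) :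
    (1 - ‖Nᵀ * V‖ ^ 2) * ‖(Uᵀ * V)⁻¹‖ ^ 2 ≤ Fintype.card κ := by
  have e := h.norm_sq_overlap_mul_ge hV (Uᵀ * V)⁻¹
  rwa [Matrix.mul_nonsing_inv _ (h.isUnit_overlap hV hZ),
    norm_sq_isometry (U := (1 : Matrix κ κ ℝ)) (by simp)] at e

/-- If `V` spans an invariant subspace of the symmetric matrix `B` and is the graph of `T` in the
frame `[U | N]`, then `T` solves a Riccati equation. -/
theorem riccati {B : Matrix m m ℝ} {K : Matrix κ κ ℝ} {T : Matrix l κ ℝ} (h : IsSplit U N)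
    (hB : Bᵀ = B) (hBV : B * V = V * K) (hW : IsUnit (Uᵀ * V).det)
    (hT : T * (Uᵀ * V) = Nᵀ * V) :
    Nᵀ * B * U + Nᵀ * B * N * T =
      T * (Uᵀ * B * U) + T * (Nᵀ * B * U)ᵀ * T := by
  have e1 : B * V = B * U * (Uᵀ * V) + B * N * (Nᵀ * V) := by
    calc B * V = B * (U * Uᵀ + N * Nᵀ) * V := by rw [h.add, Matrix.mul_one]
      _ = _ := by simp only [Matrix.mul_add, Matrix.add_mul, Matrix.mul_assoc]
  -- `B V = V K` stays in the span of `V`, that is, on the graph of `T`. Expanding `B V` in the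
  -- frame and cancelling `Uᵀ V` gives the equation.
  have e2 : Nᵀ * (B * V) = T * (Uᵀ * (B * V)) := by
    rw [hBV, ← Matrix.mul_assoc, ← Matrix.mul_assoc Uᵀ, ← hT, Matrix.mul_assoc]
  have e3 : (Nᵀ * B * U)ᵀ = Uᵀ * B * N := by
    simp only [Matrix.transpose_mul, Matrix.transpose_transpose, hB, Matrix.mul_assoc]
  rw [e1, ← hT] at e2
  have e4 : (Nᵀ * B * U + Nᵀ * B * N * T) * (Uᵀ * V) =
      (T * (Uᵀ * B * U) + T * (Nᵀ * B * U)ᵀ * T) * (Uᵀ * V) := by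
    rw [e3]
    simpa only [Matrix.mul_add, Matrix.add_mul, Matrix.mul_assoc] using e2
  have := congrArg (· * (Uᵀ * V)⁻¹) e4
  simpa only [Matrix.mul_assoc _ (Uᵀ * V) (Uᵀ * V)⁻¹, Matrix.mul_nonsing_inv _ hW,
    Matrix.mul_one] using this

theorem _root_.PCA.norm_conj_le {p q : Type*} [Fintype p] [Fintype q] (M : Matrix m m ℝ)
    (X : Matrix m p ℝ) (Y : Matrix m q ℝ) : ‖Xᵀ * M * Y‖ ≤ ‖X‖ * ‖Y‖ * ‖M‖ := by
  calc ‖Xᵀ * M * Y‖ ≤ ‖Xᵀ‖ * ‖M‖ * ‖Y‖ :=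
        (Matrix.frobenius_norm_mul _ _).trans
          (mul_le_mul_of_nonneg_right (Matrix.frobenius_norm_mul _ _) (norm_nonneg _))
    _ = _ := by rw [Matrix.frobenius_norm_transpose]; ring

theorem _root_.PCA.mul_le_sq_add_sq (x y : ℝ) : x * y ≤ y ^ 2 + x ^ 2 := by
  nlinarith [sq_nonneg (x - y), sq_nonneg x, sq_nonneg y]

/-- The defect of the linearised Riccati equation. -/
theorem norm_riccati_defect_le {A B : Matrix m m ℝ} {K : Matrix κ κ ℝ} {T : Matrix l κ ℝ}
    {a : κ → ℝ} {b : l → ℝ} (h : IsSplit U N)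
    (hA : A * U = U * diagonal a) (hA' : A * N = N * diagonal b)
    (hB : Bᵀ = B) (hBV : B * V = V * K) (hW : IsUnit (Uᵀ * V).det)
    (hT : T * (Uᵀ * V) = Nᵀ * V) (hT1 : ‖T‖ ≤ 1) :
    ‖Nᵀ * B * U‖ ≤ (Fintype.card κ + Fintype.card l) * ‖B - A‖ ∧
    ‖T * diagonal a - diagonal b * T - Nᵀ * B * U‖ ≤
      2 * (Fintype.card κ + Fintype.card l) * ‖B - A‖ * ‖T‖ := by
  have h1 : diagonal a = Uᵀ * A * U := by
    rw [Matrix.mul_assoc, hA, ← Matrix.mul_assoc, h.left, Matrix.one_mul]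
  have h2 : diagonal b = Nᵀ * A * N := by
    rw [Matrix.mul_assoc, hA', ← Matrix.mul_assoc, h.right, Matrix.one_mul]
  -- The off-diagonal block of `A` vanishes, so this block is of first order in `B - A`.
  have h3 : Nᵀ * B * U = Nᵀ * (B - A) * U := by
    rw [Matrix.mul_sub, Matrix.sub_mul, Matrix.mul_assoc Nᵀ A, hA, ← Matrix.mul_assoc Nᵀ U,
      h.cross', Matrix.zero_mul, sub_zero]
  -- The Riccati equation with each diagonal block of `B` written as that of `A` plus that of `B -
  -- A`.
  have h4 : T * diagonal a - diagonal b * T - Nᵀ * B * U =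
      Nᵀ * (B - A) * N * T - T * (Uᵀ * (B - A) * U) - T * (Nᵀ * B * U)ᵀ * T := by
    have r := h.riccati hB hBV hW hT
    rw [h1, h2]
    simp only [Matrix.mul_sub, Matrix.sub_mul]
    rw [← sub_eq_zero] at r ⊢
    rw [← neg_eq_zero, ← r]
    abel
  have nU := norm_sq_isometry h.left
  have nN := norm_sq_isometry h.right
  have he := norm_nonneg (B - A)
  have hT0 := norm_nonneg T
  have hC : ‖Nᵀ * B * U‖ ≤ (Fintype.card κ + Fintype.card l) * ‖B - A‖ := by
    rw [h3, ← nU, ← nN]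
    refine (norm_conj_le (B - A) N U).trans (mul_le_mul_of_nonneg_right ?_ he)
    exact mul_le_sq_add_sq _ _
  refine ⟨hC, ?_⟩
  rw [h4]
  have b1 : ‖Nᵀ * (B - A) * N * T‖ ≤ Fintype.card l * ‖B - A‖ * ‖T‖ := by
    refine (Matrix.frobenius_norm_mul _ _).trans (mul_le_mul_of_nonneg_right ?_ hT0)
    rw [← nN, sq]; exact norm_conj_le (B - A) N N
  have b2 : ‖T * (Uᵀ * (B - A) * U)‖ ≤ Fintype.card κ * ‖B - A‖ * ‖T‖ := by
    refine (Matrix.frobenius_norm_mul _ _).trans ?_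
    rw [mul_comm]
    refine mul_le_mul_of_nonneg_right ?_ hT0
    rw [← nU, sq]; exact norm_conj_le (B - A) U U
  -- One factor ‖T‖ of the quadratic term is bounded by 1, so that this term too is of order ‖B - A‖
  -- ‖T‖.
  have b3 : ‖T * (Nᵀ * B * U)ᵀ * T‖ ≤
      (Fintype.card κ + Fintype.card l) * ‖B - A‖ * ‖T‖ := by
    refine (Matrix.frobenius_norm_mul _ _).trans (mul_le_mul_of_nonneg_right ?_ hT0)
    refine (Matrix.frobenius_norm_mul _ _).trans ?_
    rw [Matrix.frobenius_norm_transpose]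
    calc ‖T‖ * ‖Nᵀ * B * U‖ ≤ 1 * ‖Nᵀ * B * U‖ :=
          mul_le_mul_of_nonneg_right hT1 (norm_nonneg _)
      _ ≤ _ := by rw [one_mul]; exact hC
  calc _ ≤ ‖Nᵀ * (B - A) * N * T‖ + ‖T * (Uᵀ * (B - A) * U)‖ + ‖T * (Nᵀ * B * U)ᵀ * T‖ :=
        (norm_sub_le _ _).trans (add_le_add_left (norm_sub_le _ _) _)
    _ ≤ _ := by linarith

/-- The drop of `tr (Uᵀ A U)` in terms of the graph matrix `T`. -/
theorem abs_excess_sub_le {A : Matrix m m ℝ} {T : Matrix l κ ℝ}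
    {a : κ → ℝ} {b : l → ℝ} (h : IsSplit U N)
    (hA : A * U = U * diagonal a) (hA' : A * N = N * diagonal b)
    (hV : Vᵀ * V = 1) (hT : T * (Uᵀ * V) = Nᵀ * V) :
    |(Uᵀ * A * U).trace - (Vᵀ * A * V).trace - ∑ i, ∑ j, (a j - b i) * T i j ^ 2| ≤
      (‖diagonal a‖ + ‖diagonal b‖) * Fintype.card κ * ‖T‖ ^ 4 := by
  set W := Uᵀ * V with hWdef
  set S := W * Wᵀ with hS
  -- The Gram identity reads Wᵀ (1 + Tᵀ T) W = 1, so S = W Wᵀ is the inverse of 1 + Tᵀ T.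
  have gram := h.gram_add V
  rw [hV, ← hWdef, ← hT] at gram
  have hS1 : S = 1 - Tᵀ * T * S := by
    have e1 : Wᵀ * ((1 + Tᵀ * T) * W) = 1 := by
      refine Eq.trans ?_ gram
      simp only [Matrix.transpose_mul, Matrix.add_mul, Matrix.mul_add, Matrix.one_mul,
        Matrix.mul_assoc]
    have e2 := mul_eq_one_comm.1 e1
    rw [Matrix.mul_assoc, ← hS, Matrix.add_mul, Matrix.one_mul] at e2
    exact eq_sub_of_add_eq e2
  have eA : (Vᵀ * A * V).trace = (diagonal a * S).trace + (diagonal b * (T * S * Tᵀ)).trace := by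
    rw [h.eq_of_mul hA hA', hS, ← Matrix.mul_assoc (diagonal a) W,
      Matrix.trace_mul_comm _ Wᵀ]
    have : T * (W * Wᵀ) * Tᵀ = (Nᵀ * V) * (Nᵀ * V)ᵀ := by
      rw [← hT]; simp only [Matrix.transpose_mul, Matrix.mul_assoc]
    rw [this, ← Matrix.mul_assoc (diagonal b), Matrix.trace_mul_comm _ (Nᵀ * V)ᵀ,
      ← Matrix.trace_add, hWdef]
    simp only [Matrix.transpose_mul, Matrix.transpose_transpose, Matrix.mul_add, Matrix.add_mul,
      Matrix.mul_assoc]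
  have eM : ∑ i, ∑ j, (a j - b i) * T i j ^ 2 =
      (diagonal a * (Tᵀ * T)).trace - (diagonal b * (T * Tᵀ)).trace := by
    rw [← Matrix.mul_assoc, Matrix.trace_mul_comm, ← Matrix.mul_assoc (diagonal b),
      Matrix.trace_mul_comm _ Tᵀ, ← Matrix.mul_assoc Tᵀ, trace_diagonal_conj,
      ← Matrix.mul_assoc T]
    have := trace_diagonal_conj a Tᵀ
    rw [Matrix.transpose_transpose] at this
    rw [this]
    simp only [sub_mul, Finset.sum_sub_distrib, Finset.mul_sum, Matrix.transpose_apply]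
    rw [Finset.sum_comm]
  have eU : (Uᵀ * A * U).trace = (diagonal a).trace := by
    rw [h.trace_self hA, Matrix.trace_diagonal]
  -- Substituting S = 1 - Tᵀ T S twice in the `a`-term and once in the `b`-term cancels everything
  -- up to second order and leaves a remainder quartic in `T`.
  have key : (Uᵀ * A * U).trace - (Vᵀ * A * V).trace - ∑ i, ∑ j, (a j - b i) * T i j ^ 2 =
      (diagonal b * (T * (Tᵀ * T * S) * Tᵀ)).trace
        - (diagonal a * (Tᵀ * T * (Tᵀ * T * S))).trace := by
    have c1 : (diagonal a * S).trace = (diagonal a).trace - (diagonal a * (Tᵀ * T)).trace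
        + (diagonal a * (Tᵀ * T * (Tᵀ * T * S))).trace := by
      rw [← Matrix.trace_sub, ← Matrix.trace_add]
      congr 1
      calc diagonal a * S = diagonal a * (1 - Tᵀ * T * (1 - Tᵀ * T * S)) := by
            rw [← hS1, ← hS1]
        _ = _ := by
          simp only [Matrix.mul_sub, Matrix.mul_one]
          abel
    have c2 : (diagonal b * (T * S * Tᵀ)).trace = (diagonal b * (T * Tᵀ)).trace
        - (diagonal b * (T * (Tᵀ * T * S) * Tᵀ)).trace := by
      rw [← Matrix.trace_sub]
      congr 1
      calc diagonal b * (T * S * Tᵀ) = diagonal b * (T * (1 - Tᵀ * T * S) * Tᵀ) := by rw [← hS1]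
        _ = _ := by simp only [Matrix.mul_sub, Matrix.sub_mul, Matrix.mul_one]
    rw [eU, eA, eM, c1, c2]; ring
  have nS : ‖S‖ ≤ Fintype.card κ := by
    have e := h.norm_sq_add V
    rw [norm_sq_isometry hV, ← hWdef] at e
    have := Matrix.frobenius_norm_mul W Wᵀ
    rw [Matrix.frobenius_norm_transpose] at this
    nlinarith [sq_nonneg ‖Nᵀ * V‖]
  have hT0 := norm_nonneg T
  have nTS : ‖Tᵀ * T * S‖ ≤ ‖T‖ ^ 2 * Fintype.card κ := by
    refine (Matrix.frobenius_norm_mul _ _).trans ?_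
    refine mul_le_mul ?_ nS (norm_nonneg _) (by positivity)
    have := Matrix.frobenius_norm_mul Tᵀ T
    rwa [Matrix.frobenius_norm_transpose, ← sq] at this
  have n1 : ‖T * (Tᵀ * T * S) * Tᵀ‖ ≤ ‖T‖ ^ 4 * Fintype.card κ := by
    calc _ ≤ ‖T‖ * ‖Tᵀ * T * S‖ * ‖Tᵀ‖ :=
          (Matrix.frobenius_norm_mul _ _).trans
            (mul_le_mul_of_nonneg_right (Matrix.frobenius_norm_mul _ _) (norm_nonneg _))
      _ ≤ ‖T‖ * (‖T‖ ^ 2 * Fintype.card κ) * ‖T‖ := by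
          rw [Matrix.frobenius_norm_transpose]; gcongr
      _ = _ := by ring
  have n2 : ‖Tᵀ * T * (Tᵀ * T * S)‖ ≤ ‖T‖ ^ 4 * Fintype.card κ := by
    calc _ ≤ ‖Tᵀ‖ * ‖T‖ * ‖Tᵀ * T * S‖ :=
          (Matrix.frobenius_norm_mul _ _).trans
            (mul_le_mul_of_nonneg_right (Matrix.frobenius_norm_mul _ _) (norm_nonneg _))
      _ ≤ ‖T‖ * ‖T‖ * (‖T‖ ^ 2 * Fintype.card κ) := by
          rw [Matrix.frobenius_norm_transpose]; gcongr
      _ = _ := by ring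
  rw [key]
  calc _ ≤ |(diagonal b * (T * (Tᵀ * T * S) * Tᵀ)).trace|
        + |(diagonal a * (Tᵀ * T * (Tᵀ * T * S))).trace| := abs_sub _ _
    _ ≤ ‖diagonal b‖ * (‖T‖ ^ 4 * Fintype.card κ) + ‖diagonal a‖ * (‖T‖ ^ 4 * Fintype.card κ) :=
        add_le_add
          ((abs_trace_mul_le _ _).trans (mul_le_mul_of_nonneg_left n1 (norm_nonneg _)))
          ((abs_trace_mul_le _ _).trans (mul_le_mul_of_nonneg_left n2 (norm_nonneg _)))
    _ = _ := by ring

end IsSplit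

/-! ### First-order expansion of the graph and second-order expansion of the trace. -/

/-- The solution of the linearised Riccati equation. -/
def linearGraph {m κ l : Type*} [Fintype m] (U : Matrix m κ ℝ) (N : Matrix m l ℝ)
    (a : κ → ℝ) (b : l → ℝ) (B : Matrix m m ℝ) : Matrix l κ ℝ :=
  Matrix.of fun i j => (Nᵀ * B * U) i j / (a j - b i)

namespace IsSplit

variable {m κ l : Type*} [Fintype m] [Fintype κ] [Fintype l] [DecidableEq m]
    [DecidableEq κ] [DecidableEq l] {U V : Matrix m κ ℝ} {N N' : Matrix m l ℝ}

/-- The smallness condition on `B - A` has two uses: it forces ‖T‖ ≤ 1, and it lets the Riccati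
defect be absorbed into half of the gap times ‖T‖, so that `T` is controlled by the block `Nᵀ B U`
alone. Dividing the defect entrywise by the gaps compares `T` with the linearised solution. -/
theorem graph_estimates [Nonempty κ] {A B : Matrix m m ℝ} {a a' : κ → ℝ} {b b' : l → ℝ}
    {α β α' : ℝ} (h : IsSplit U N) (hA : A * U = U * diagonal a) (hA' : A * N = N * diagonal b)
    (ha : ∀ j, α ≤ a j) (hb : ∀ i, b i ≤ β) (hαβ : β < α)
    (h' : IsSplit V N') (hB : B * V = V * diagonal a') (hB' : B * N' = N' * diagonal b')
    (ha' : ∀ j, α' ≤ a' j) (hb' : ∀ i, b' i ≤ α') {s : ℝ}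
    (hs : s = (Fintype.card κ : ℝ) + Fintype.card l)
    (he : 4 * s ^ 2 * ‖B - A‖ ≤ α - β) :
    ∃ T : Matrix l κ ℝ, IsUnit (Uᵀ * V).det ∧ T * (Uᵀ * V) = Nᵀ * V ∧ ‖T‖ ≤ 1 ∧
      ‖Nᵀ * B * U‖ ≤ s * ‖B - A‖ ∧ (α - β) * ‖T‖ ≤ 2 * ‖Nᵀ * B * U‖ ∧
      (α - β) * ‖linearGraph U N a b B‖ ≤ ‖Nᵀ * B * U‖ ∧
      (α - β) * ‖T - linearGraph U N a b B‖ ≤ 2 * s * ‖B - A‖ * ‖T‖ ∧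
      |∑ i, ∑ j, (a j - b i) * T i j ^ 2 - ∑ i, ∑ j, (Nᵀ * B * U) i j ^ 2 / (a j - b i)| ≤
        2 * s * ‖B - A‖ * ‖T‖ * (‖T‖ + ‖linearGraph U N a b B‖) := by
  set g := α - β with hg
  have hg0 : 0 < g := sub_pos.2 hαβ
  set e := ‖B - A‖ with hedef
  have he0 : 0 ≤ e := norm_nonneg _
  have hk1 : (1 : ℝ) ≤ Fintype.card κ := by exact_mod_cast Fintype.card_pos
  have hl0 : (0 : ℝ) ≤ Fintype.card l := by positivity
  have hks : (Fintype.card κ : ℝ) ≤ s := by rw [hs]; linarith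
  have hs1 : 1 ≤ s := hk1.trans hks
  have hZ := h.perturbation hA hA' ha hb h' hB hB' ha' hb'
  rw [← hg, ← hedef] at hZ
  -- smallness of the overlap with the trailing frame
  have hZ2 : 2 * Fintype.card κ * ‖Nᵀ * V‖ ^ 2 ≤ 1 := by
    have h1 : g * (2 * Fintype.card κ * ‖Nᵀ * V‖ ^ 2) ≤ g * 1 := by
      calc g * (2 * Fintype.card κ * ‖Nᵀ * V‖ ^ 2) = 2 * Fintype.card κ * (g * ‖Nᵀ * V‖ ^ 2) := by
            ring
        _ ≤ 2 * Fintype.card κ * (2 * Fintype.card κ * e) := by gcongr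
        _ = 4 * (Fintype.card κ : ℝ) ^ 2 * e := by ring
        _ ≤ 4 * s ^ 2 * e := by gcongr
        _ ≤ g * 1 := by rw [mul_one]; exact he
    exact le_of_mul_le_mul_left h1 hg0
  have hZ0 := sq_nonneg ‖Nᵀ * V‖
  have hZ3 : ‖Nᵀ * V‖ ^ 2 ≤ 1 / 2 := by nlinarith
  have hZ1 : ‖Nᵀ * V‖ ^ 2 < 1 := by linarith
  have hW := h.isUnit_overlap h'.left hZ1
  have hWi := h.norm_sq_inv_overlap_le h'.left hZ1
  set T := Nᵀ * V * (Uᵀ * V)⁻¹ with hTdef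
  have hT : T * (Uᵀ * V) = Nᵀ * V := by
    rw [hTdef, Matrix.mul_assoc, Matrix.nonsing_inv_mul _ hW, Matrix.mul_one]
  have hT0 := norm_nonneg T
  -- ‖Nᵀ V‖² ≤ 1/2 gives ‖(Uᵀ V)⁻¹‖² ≤ 2k, which is exactly compensated by 2k ‖Nᵀ V‖² ≤ 1.
  have hT1 : ‖T‖ ≤ 1 := by
    have h1 := pow_le_pow_left₀ hT0 (Matrix.frobenius_norm_mul (Nᵀ * V) (Uᵀ * V)⁻¹) 2
    rw [mul_pow] at h1
    have h2 : ‖(Uᵀ * V)⁻¹‖ ^ 2 ≤ 2 * Fintype.card κ := by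
      nlinarith [sq_nonneg ‖(Uᵀ * V)⁻¹‖]
    have h3 := mul_le_mul_of_nonneg_left h2 hZ0
    refine (sq_le_one_iff₀ hT0).1 ?_
    linarith
  obtain ⟨hC, hR⟩ := h.norm_riccati_defect_le hA hA' (h'.isSymm_of_mul hB hB') hB hW hT hT1
  rw [← hs, ← hedef] at hC hR
  set C := Nᵀ * B * U with hCdef
  set R := T * diagonal a - diagonal b * T - C with hRdef
  set F := linearGraph U N a b B with hFdef
  have hδ : ∀ i j, g ≤ a j - b i := fun i j => by linarith [ha j, hb i]
  have hδ0 : ∀ i j, 0 < a j - b i := fun i j => hg0.trans_le (hδ i j)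
  have hF : ∀ i j, (a j - b i) * F i j = C i j := fun i j => by
    rw [hFdef, linearGraph, Matrix.of_apply, mul_div_cancel₀ _ (hδ0 i j).ne']
  have hRe : ∀ i j, R i j = (a j - b i) * (T - F) i j := fun i j => by
    rw [Matrix.sub_apply, mul_sub, hF]
    simp only [hRdef, Matrix.sub_apply, Matrix.mul_diagonal, Matrix.diagonal_mul]
    ring
  have hgTF : g * ‖T - F‖ ≤ ‖R‖ := mul_norm_le_of_entries hg0.le fun i j => by
    rw [hRe, abs_mul, abs_of_pos (hδ0 i j)]
    exact mul_le_mul_of_nonneg_right (hδ i j) (abs_nonneg _)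
  have hgF : g * ‖F‖ ≤ ‖C‖ := mul_norm_le_of_entries hg0.le fun i j => by
    rw [← hF, abs_mul, abs_of_pos (hδ0 i j)]
    exact mul_le_mul_of_nonneg_right (hδ i j) (abs_nonneg _)
  refine ⟨T, hW, hT, hT1, hC, ?_, hgF, hgTF.trans hR, ?_⟩
  · have h1 : g * ‖T‖ ≤ g * ‖T - F‖ + g * ‖F‖ := by
      rw [← mul_add]
      refine mul_le_mul_of_nonneg_left ?_ hg0.le
      simpa using norm_add_le (T - F) F
    -- Hence g ‖T - F‖ ≤ 2 s e ‖T‖ ≤ g ‖T‖ / 2, which is moved to the left-hand side.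
    have h2 : 4 * s * e ≤ g := by nlinarith [mul_nonneg (by linarith : (0:ℝ) ≤ s) he0]
    have h3 := mul_le_mul_of_nonneg_right h2 hT0
    linarith
  -- With C = δ F and R = δ (T - F), the difference of squares δ T² - C²/δ factors as R (T + F);
  -- Cauchy–Schwarz then applies.
  · have h1 : ∑ i, ∑ j, (a j - b i) * T i j ^ 2 - ∑ i, ∑ j, C i j ^ 2 / (a j - b i) =
        ∑ i, ∑ j, R i j * (T + F) i j := by
      rw [← Finset.sum_sub_distrib]
      refine Finset.sum_congr rfl fun i _ => ?_
      rw [← Finset.sum_sub_distrib]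
      refine Finset.sum_congr rfl fun j _ => ?_
      rw [hRe, ← hF, Matrix.sub_apply, Matrix.add_apply]
      have := (hδ0 i j).ne'
      field_simp
      ring
    rw [h1]
    refine (abs_sum_mul_le _ _).trans ?_
    exact mul_le_mul hR (norm_add_le _ _) (norm_nonneg _) (by positivity)

/-- First-order expansion of the graph matrix and of the excess trace, uniformly in the
perturbation `B` of `A`. -/
theorem exists_expansion [Nonempty κ] {A : Matrix m m ℝ} {a : κ → ℝ} {b : l → ℝ}
    {α β : ℝ} (h : IsSplit U N) (hA : A * U = U * diagonal a) (hA' : A * N = N * diagonal b)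
    (ha : ∀ j, α ≤ a j) (hb : ∀ i, b i ≤ β) (hαβ : β < α) :
    ∃ c ε : ℝ, 0 ≤ c ∧ 0 < ε ∧ ∀ (V : Matrix m κ ℝ) (N' : Matrix m l ℝ) (B : Matrix m m ℝ)
      (a' : κ → ℝ) (b' : l → ℝ) (α' : ℝ), IsSplit V N' → B * V = V * diagonal a' →
      B * N' = N' * diagonal b' → (∀ j, α' ≤ a' j) → (∀ i, b' i ≤ α') → ‖B - A‖ ≤ ε →
      ∃ T : Matrix l κ ℝ, IsUnit (Uᵀ * V).det ∧ T * (Uᵀ * V) = Nᵀ * V ∧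
        ‖T‖ ^ 2 + ‖T - linearGraph U N a b B‖ ≤ c * (‖Nᵀ * B * U‖ * ‖B - A‖) ∧
        |(Uᵀ * A * U).trace - (Vᵀ * A * V).trace
          - ∑ i, ∑ j, (Nᵀ * B * U) i j ^ 2 / (a j - b i)| ≤
          c * (‖Nᵀ * B * U‖ ^ 2 * ‖B - A‖) := by
  obtain ⟨s, hs⟩ : ∃ s : ℝ, s = (Fintype.card κ : ℝ) + Fintype.card l := ⟨_, rfl⟩
  have hs0 : 0 < s := by
    have : (0 : ℝ) < Fintype.card κ := by exact_mod_cast Fintype.card_pos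
    rw [hs]; positivity
  obtain ⟨g, hg⟩ : ∃ g : ℝ, g = α - β := ⟨_, rfl⟩
  have hg0 : 0 < g := by rw [hg]; exact sub_pos.2 hαβ
  set q := (‖diagonal a‖ + ‖diagonal b‖) * Fintype.card κ with hq
  have hq0 : 0 ≤ q := by positivity
  -- The first summand serves the graph bound. The bracket serves the trace bound, with `q` for the
  -- quartic remainder and `12` for the comparison of quadratic forms. The radius is the smallness
  -- condition of `graph_estimates`.
  refine ⟨8 * s / g ^ 2 + (q * (8 * s / g ^ 3) + 12 * s / g ^ 2), g / (4 * s ^ 2), by positivity,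
    by positivity, ?_⟩
  intro V N' B a' b' α' h' hB hB' ha' hb' he
  rw [le_div_iff₀ (by positivity), mul_comm, hg] at he
  obtain ⟨T, hW, hT, hT1, hC, hTC, hFC, hTF, hquad⟩ :=
    h.graph_estimates hA hA' ha hb hαβ h' hB hB' ha' hb' hs he
  refine ⟨T, hW, hT, ?_⟩
  have hexc := h.abs_excess_sub_le hA hA' h'.left hT
  rw [← hq] at hexc
  rw [← hg] at hTC hFC hTF
  generalize linearGraph U N a b B = F at *
  generalize ‖T - F‖ = z at *
  generalize hCn : ‖Nᵀ * B * U‖ = C at *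
  have hC0 : 0 ≤ C := hCn ▸ norm_nonneg _
  generalize hen : ‖B - A‖ = e at *
  have he0 : 0 ≤ e := hen ▸ norm_nonneg _
  generalize hTn : ‖T‖ = t at *
  have ht0 : 0 ≤ t := hTn ▸ norm_nonneg _
  generalize hFn : ‖F‖ = f at *
  have hf0 : 0 ≤ f := hFn ▸ norm_nonneg _
  have t1 : t ≤ 2 / g * C := by
    rw [div_mul_eq_mul_div, le_div_iff₀ hg0]; linarith
  have f1 : f ≤ 1 / g * C := by
    rw [div_mul_eq_mul_div, le_div_iff₀ hg0]; linarith
  have t2 : t ≤ 2 / g * (s * e) := t1.trans (by gcongr)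
  have z1 : z ≤ 2 * s / g * e * t := by
    have : z * g ≤ 2 * s * e * t := by linarith
    calc z ≤ 2 * s * e * t / g := by rwa [le_div_iff₀ hg0]
      _ = _ := by ring
  constructor
  · have y1 : t ^ 2 ≤ (2 / g * C) * (2 / g * (s * e)) := by
      rw [sq]; exact mul_le_mul t1 t2 ht0 (by positivity)
    have y2 : z ≤ 2 * s / g * e * (2 / g * C) := z1.trans (by gcongr)
    have y3 : 0 ≤ (q * (8 * s / g ^ 3) + 12 * s / g ^ 2) * (C * e) := by positivity
    calc t ^ 2 + z ≤ (2 / g * C) * (2 / g * (s * e)) + 2 * s / g * e * (2 / g * C) :=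
          add_le_add y1 y2
      _ = 8 * s / g ^ 2 * (C * e) := by field_simp; ring
      _ ≤ _ := by rw [add_mul]; linarith
  -- Of the four factors one is bounded by 1, two by ‖Nᵀ B U‖ and one by ‖B - A‖; this leaves
  -- exactly the two factors ‖Nᵀ B U‖ that the scaling by n can absorb.
  · have y1 : t ^ 4 ≤ (2 / g * C) ^ 2 * (2 / g * (s * e)) := by
      calc t ^ 4 = t ^ 2 * t * t := by ring
        _ ≤ t ^ 2 * t * 1 := by gcongr
        _ = t ^ 2 * t := by ring
        _ ≤ _ := by gcongr
    have y2 : 2 * s * e * t * (t + f) ≤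
        2 * s * e * (2 / g * C) * (2 / g * C + 1 / g * C) := by gcongr
    have y3 : 0 ≤ 8 * s / g ^ 2 * (C ^ 2 * e) := by positivity
    have y4 := mul_le_mul_of_nonneg_left y1 hq0
    have tri := abs_sub_le ((Uᵀ * A * U).trace - (Vᵀ * A * V).trace)
      (∑ i, ∑ j, (a j - b i) * T i j ^ 2) (∑ i, ∑ j, (Nᵀ * B * U) i j ^ 2 / (a j - b i))
    calc _ ≤ _ := tri
      _ ≤ q * ((2 / g * C) ^ 2 * (2 / g * (s * e))) +
          2 * s * e * (2 / g * C) * (2 / g * C + 1 / g * C) :=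
        add_le_add (hexc.trans y4) (hquad.trans y2)
      _ = (q * (8 * s / g ^ 3) + 12 * s / g ^ 2) * (C ^ 2 * e) := by field_simp; ring
      _ ≤ _ := by rw [add_mul]; linarith

end IsSplit

/-! ### Leading and trailing frames of an ordered eigenbasis. -/

section Frames

variable {d k : ℕ}

theorem sum_head_add_sum_tail {M : Type*} [AddCommMonoid M] (hkd : k ≤ d) (f : Fin d → M) :
    ∑ j, f (headIdx hkd j) + ∑ i, f (tailIdx hkd i) = ∑ j, f j := by
  rw [← Equiv.sum_comp (finSumFinEquiv.trans (finCongr (Nat.add_sub_of_le hkd))) f,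
    Fintype.sum_sum_type]
  rfl

theorem isSplit_frames (hkd : k ≤ d) (u : OrthonormalBasis (Fin d) ℝ (EuclideanSpace ℝ (Fin d))) :
    IsSplit (leadingFrame hkd u).1 (trailingFrame hkd u).1 where
  left := (leadingFrame hkd u).2
  right := (trailingFrame hkd u).2
  add := by
    have h := mul_eq_one_comm.1 (frame u (Function.Embedding.refl (Fin d))).2
    ext a b
    rw [← h, Matrix.add_apply, Matrix.mul_apply, Matrix.mul_apply, Matrix.mul_apply]
    exact sum_head_add_sum_tail hkd fun j => u j a * u j b

theorem IsOrderedEigenbasis.mul_frame {A : Matrix (Fin d) (Fin d) ℝ}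
    {u : OrthonormalBasis (Fin d) ℝ (EuclideanSpace ℝ (Fin d))} {lam : Fin d → ℝ}
    (h : IsOrderedEigenbasis A u lam) {m : ℕ} (e : Fin m ↪ Fin d) :
    A * (frame u e).1 = (frame u e).1 * diagonal fun j => lam (e j) := by
  ext a j
  have := congrArg (fun z : EuclideanSpace ℝ (Fin d) => z a) (h.apply_eq (e j))
  simp only [Matrix.toLpLin_apply, PiLp.smul_apply, smul_eq_mul, Matrix.mulVec, dotProduct] at this
  rw [Matrix.mul_diagonal, Matrix.mul_apply, mul_comm]
  exact this

theorem IsOrderedEigenbasis.le_head {A : Matrix (Fin d) (Fin d) ℝ}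
    {u : OrthonormalBasis (Fin d) ℝ (EuclideanSpace ℝ (Fin d))} {lam : Fin d → ℝ}
    (h : IsOrderedEigenbasis A u lam) (hkd : k ≤ d) (hk' : k - 1 < d) (j : Fin k) :
    lam ⟨k - 1, hk'⟩ ≤ lam (headIdx hkd j) :=
  h.antitone (by
    change (j : ℕ) ≤ k - 1
    omega)

theorem IsOrderedEigenbasis.tail_le {A : Matrix (Fin d) (Fin d) ℝ}
    {u : OrthonormalBasis (Fin d) ℝ (EuclideanSpace ℝ (Fin d))} {lam : Fin d → ℝ}
    (h : IsOrderedEigenbasis A u lam) (hkd : k < d) (i : Fin (d - k)) :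
    lam (tailIdx hkd.le i) ≤ lam ⟨k, hkd⟩ :=
  h.antitone (by
    change k ≤ k + (i : ℕ)
    omega)

end Frames

/-! ### Singular values, principal angles and the Riemannian distance. -/

section SingularValues

variable {m n d k : ℕ}

theorem norm_toEuclideanLin_sq (A : Matrix (Fin m) (Fin n) ℝ) (x : EuclideanSpace ℝ (Fin n)) :
    ‖Matrix.toEuclideanLin A x‖ ^ 2 = ‖A * Matrix.replicateCol Unit (WithLp.ofLp x)‖ ^ 2 := by
  rw [← Matrix.replicateCol_mulVec, Matrix.frobenius_norm_replicateCol]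
  rfl

/-- The hypothesis is tested on an eigenvector of `Aᵀ A` for the eigenvalue s_j². -/
theorem le_sq_matrixSingularValue {A : Matrix (Fin m) (Fin n) ℝ} {c : ℝ}
    (h : ∀ X : Matrix (Fin n) Unit ℝ, c * ‖X‖ ^ 2 ≤ ‖A * X‖ ^ 2) (j : Fin n) :
    c ≤ matrixSingularValue A j ^ 2 := by
  set T := Matrix.toEuclideanLin A with hT
  have hj : (j : ℕ) < Module.finrank ℝ (EuclideanSpace ℝ (Fin n)) := by simp
  obtain ⟨v, hv⟩ := (T.hasEigenvalue_adjoint_comp_self_sq_singularValues hj).exists_hasEigenvector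
  have h1 : ‖T v‖ ^ 2 = matrixSingularValue A j ^ 2 * ‖v‖ ^ 2 := by
    have h2 : inner ℝ (LinearMap.adjoint T (T v)) v = ‖T v‖ ^ 2 := by
      rw [LinearMap.adjoint_inner_left, real_inner_self_eq_norm_sq]
    rw [← h2]
    have h3 := hv.apply_eq_smul
    rw [LinearMap.comp_apply] at h3
    rw [h3, inner_smul_left, real_inner_self_eq_norm_sq]
    rfl
  have h4 := h (Matrix.replicateCol Unit (WithLp.ofLp v))
  rw [← norm_toEuclideanLin_sq, ← hT, h1, Matrix.frobenius_norm_replicateCol] at h4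
  have h5 : 0 < ‖v‖ ^ 2 := pow_pos (norm_pos_iff.2 hv.2) 2
  exact le_of_mul_le_mul_right h4 h5

/-- An angle arccos s is below π/2 exactly when s > 0, and all `k` singular values are positive
exactly when the square matrix is injective. -/
theorem logDefined_mk_iff (U V : Stiefel d k) :
    LogDefined (Grassmannian.mk U) (Grassmannian.mk V) ↔ IsUnit (U.1ᵀ * V.1).det := by
  have h1 : LogDefined (Grassmannian.mk U) (Grassmannian.mk V) ↔
      ∀ j : Fin k, 0 < matrixSingularValue (U.1ᵀ * V.1) j :=
    forall_congr' fun j => Real.arccos_lt_pi_div_two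
  have h2 : (∀ j : Fin k, 0 < matrixSingularValue (U.1ᵀ * V.1) j) ↔
      Function.Injective (Matrix.toEuclideanLin (U.1ᵀ * V.1)) := by
    rw [LinearMap.injective_iff_forall_lt_finrank_singularValues_pos]
    simp only [finrank_euclideanSpace, Fintype.card_fin]
    exact ⟨fun h i hi => h ⟨i, hi⟩, fun h j => h j j.2⟩
  rw [h1, h2, ← Matrix.isUnit_iff_isUnit_det, ← Matrix.mulVec_injective_iff_isUnit]
  constructor
  · intro h x y hxy
    have := @h (WithLp.toLp 2 x) (WithLp.toLp 2 y) (by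
      rw [Matrix.toLpLin_apply, Matrix.toLpLin_apply]; exact congrArg _ hxy)
    exact congrArg WithLp.ofLp this
  · intro h x y hxy
    rw [Matrix.toLpLin_apply, Matrix.toLpLin_apply] at hxy
    have := @h (WithLp.ofLp x) (WithLp.ofLp y) (congrArg WithLp.ofLp hxy)
    exact congrArg (WithLp.toLp 2) this

/-- Pythagoras in both splittings gives ‖N'ᵀ U‖ = ‖Nᵀ V‖, so every singular value of `Vᵀ U` is at
least √(1 - ‖Nᵀ V‖²) and one arccos bounds all angles. -/
theorem grDist_le {U V : Stiefel d k} {l : Type*} [Fintype l] [DecidableEq l]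
    {N N' : Matrix (Fin d) l ℝ} (h : IsSplit U.1 N) (h' : IsSplit V.1 N') :
    grDist (Grassmannian.mk V) (Grassmannian.mk U) ≤
      √(k * Real.arccos √(1 - ‖Nᵀ * V.1‖ ^ 2) ^ 2) := by
  have e : ‖N'ᵀ * U.1‖ ^ 2 = ‖Nᵀ * V.1‖ ^ 2 := by
    have e1 := h.norm_sq_add V.1
    have e2 := h'.norm_sq_add U.1
    rw [norm_sq_isometry V.2] at e1
    rw [norm_sq_isometry U.2] at e2
    have e3 : ‖U.1ᵀ * V.1‖ = ‖V.1ᵀ * U.1‖ := by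
      rw [← Matrix.frobenius_norm_transpose, Matrix.transpose_mul, Matrix.transpose_transpose]
    rw [e3] at e1
    linarith
  refine Real.sqrt_le_sqrt ?_
  have : ∀ j : Fin k, principalAngle (Grassmannian.mk V) (Grassmannian.mk U) j ^ 2 ≤
      Real.arccos √(1 - ‖Nᵀ * V.1‖ ^ 2) ^ 2 := by
    intro j
    have h1 := le_sq_matrixSingularValue
      (fun X : Matrix (Fin k) Unit ℝ => h'.norm_sq_overlap_mul_ge U.2 X) j
    rw [e] at h1
    refine pow_le_pow_left₀ (Real.arccos_nonneg _) (Real.arccos_le_arccos ?_) 2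
    exact (Real.sqrt_le_left (LinearMap.singularValues_nonneg _ _)).2 h1
  calc _ ≤ ∑ _j : Fin k, Real.arccos √(1 - ‖Nᵀ * V.1‖ ^ 2) ^ 2 :=
        Finset.sum_le_sum fun j _ => this j
    _ = _ := by simp

theorem exists_grDist_le (d k : ℕ) {ε : ℝ} (hε : 0 < ε) : ∃ η : ℝ, 0 < η ∧
    ∀ (U V : Stiefel d k) (N N' : Matrix (Fin d) (Fin (d - k)) ℝ), IsSplit U.1 N →
      IsSplit V.1 N' → ‖Nᵀ * V.1‖ ^ 2 < η →
      grDist (Grassmannian.mk V) (Grassmannian.mk U) ≤ ε := by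
  have hc : Continuous fun z : ℝ => √(k * Real.arccos √(1 - z) ^ 2) := by
    have := Real.continuous_arccos
    fun_prop
  have h0 := hc.tendsto 0
  simp only [sub_zero, Real.sqrt_one, Real.arccos_one, ne_eq, OfNat.ofNat_ne_zero,
    not_false_eq_true, zero_pow, mul_zero, Real.sqrt_zero] at h0
  obtain ⟨η, hη, h1⟩ := Metric.eventually_nhds_iff.1 (h0.eventually (gt_mem_nhds hε))
  refine ⟨η, hη, fun U V N N' h h' hlt => (grDist_le h h').trans (h1 ?_).le⟩
  rwa [Real.dist_eq, sub_zero, abs_of_nonneg (sq_nonneg _)]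

end SingularValues

/-! ### The lifted logarithm compared with the graph matrix. -/

section LiftLog

variable {d k : ℕ}

/-- The true order is cubic; a quadratic bound suffices because the expansion of the graph allows an
error of order ‖T‖² anyway. -/
theorem abs_arctan_sub_le {x : ℝ} (hx : 0 ≤ x) : |Real.arctan x - x| ≤ x ^ 2 := by
  have h1 : Real.arctan x ≤ x := by
    have h0 : 0 ≤ Real.arctan x := Real.arctan_nonneg.2 hx
    have := Real.le_tan h0 (Real.arctan_lt_pi_div_two x)
    rwa [Real.tan_arctan] at this
  have h2 : x - x ^ 2 ≤ Real.arctan x := by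
    have hm : MonotoneOn (fun y : ℝ => Real.arctan y - (y - y ^ 2)) (Set.Ici 0) := by
      have hd : ∀ y : ℝ, HasDerivAt (fun y : ℝ => Real.arctan y - (y - y ^ 2))
          (1 / (1 + y ^ 2) - (1 - 2 * y)) y := fun y => by
        have := (Real.hasDerivAt_arctan y).sub ((hasDerivAt_id y).sub (hasDerivAt_pow 2 y))
        convert! this using 2
        simp
      refine monotoneOn_of_deriv_nonneg (convex_Ici 0)
        (fun y _ => (hd y).continuousAt.continuousWithinAt)
        (fun y _ => (hd y).differentiableAt.differentiableWithinAt) ?_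
      intro y hy
      rw [interior_Ici, Set.mem_Ioi] at hy
      rw [(hd y).deriv, sub_nonneg, le_div_iff₀ (by positivity)]
      nlinarith [sq_nonneg (y - 1), mul_pos hy hy, mul_pos (mul_pos hy hy) hy]
    have := hm (Set.mem_Ici.2 le_rfl) (Set.mem_Ici.2 hx) hx
    simp only [Real.arctan_zero] at this
    linarith
  rw [abs_le]
  constructor <;> nlinarith [sq_nonneg x]

theorem norm_sq_svd {P : Matrix (Fin d) (Fin k) ℝ} {Q : Matrix (Fin k) (Fin k) ℝ}
    (hP : Pᵀ * P = 1) (hQ : Q ∈ Matrix.orthogonalGroup (Fin k) ℝ) (t : Fin k → ℝ) :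
    ‖P * Matrix.diagonal t * Qᵀ‖ ^ 2 = ∑ j, t j ^ 2 := by
  rw [Matrix.mul_assoc, norm_isometry_mul hP, ← Matrix.frobenius_norm_transpose,
    Matrix.transpose_mul, Matrix.transpose_transpose, Matrix.diagonal_transpose,
    norm_isometry_mul ((Matrix.mem_orthogonalGroup_iff' (Fin k) ℝ).1 hQ),
    Matrix.frobenius_norm_diagonal, PiLp.norm_sq_eq_of_L2]
  simp

/-- Both matrices share the factors `P` and `Q`, so the squared norm of the difference is ∑ (arctan
s_j - s_j)², at most ∑ s_j⁴ and hence at most (∑ s_j²)². -/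
theorem IsThinSVD.norm_arctan_sub_le {M P : Matrix (Fin d) (Fin k) ℝ}
    {s : Fin k → ℝ} {Q : Matrix (Fin k) (Fin k) ℝ} (h : IsThinSVD M P s Q) :
    ‖P * Matrix.diagonal (fun j => Real.arctan (s j)) * Qᵀ - M‖ ≤ ‖M‖ ^ 2 := by
  refine (sq_le_sq₀ (norm_nonneg _) (sq_nonneg _)).1 ?_
  have e : P * Matrix.diagonal (fun j => Real.arctan (s j)) * Qᵀ - M =
      P * Matrix.diagonal (fun j => Real.arctan (s j) - s j) * Qᵀ := by
    conv_lhs => rw [h.eq_mul]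
    rw [← Matrix.sub_mul, ← Matrix.mul_sub, Matrix.diagonal_sub]
  have hM : ‖M‖ ^ 2 = ∑ j, s j ^ 2 := by
    conv_lhs => rw [h.eq_mul]
    exact norm_sq_svd h.left_orthonormal h.right_orthogonal s
  rw [e, norm_sq_svd h.left_orthonormal h.right_orthogonal, hM]
  calc ∑ j, (Real.arctan (s j) - s j) ^ 2 ≤ ∑ j, (s j ^ 2) ^ 2 :=
        Finset.sum_le_sum fun j _ => sq_le_sq.2 (by
          rw [abs_of_nonneg (sq_nonneg (s j))]; exact abs_arctan_sub_le (h.nonneg j))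
    _ ≤ (∑ j, s j ^ 2) ^ 2 := Finset.sum_sq_le_sq_sum_of_nonneg fun j _ => sq_nonneg _

/-- The matrix whose singular value decomposition defines the logarithm is `N * T`, whichever
representative of the class is chosen, and `N` preserves the norm. -/
theorem norm_liftLog_sub_le (hkd : k ≤ d) {U V : Stiefel d k} {l : Type*} [Fintype l]
    [DecidableEq l] {N : Matrix (Fin d) l ℝ} (h : IsSplit U.1 N) (hW : IsUnit (U.1ᵀ * V.1).det)
    {T : Matrix l (Fin k) ℝ} (hT : T * (U.1ᵀ * V.1) = Nᵀ * V.1) (D : Matrix (Fin d) (Fin k) ℝ) :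
    ‖liftLog U (Grassmannian.mk V) D - N * T‖ ≤ ‖T‖ ^ 2 := by
  obtain ⟨V', hV', P, s, Q, hsvd, hΔ⟩ :=
    liftLog_spec hkd U _ D ((logDefined_mk_iff U V).2 hW)
  obtain ⟨O, hO, hVO⟩ : ∃ O ∈ Matrix.orthogonalGroup (Fin k) ℝ, V'.1 = V.1 * O :=
    Quotient.exact (s := stiefelSetoid d k) hV'.symm
  have hO1 : O * Oᵀ = 1 := (Matrix.mem_orthogonalGroup_iff (Fin k) ℝ).1 hO
  have hOu : IsUnit O.det := (Matrix.isUnit_iff_isUnit_det O).1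
    (IsUnit.of_mul_eq_one _ hO1)
  have hWO : IsUnit (U.1ᵀ * V'.1).det := by
    rw [hVO, ← Matrix.mul_assoc, Matrix.det_mul]; exact hW.mul hOu
  have hM : (1 - U.1 * U.1ᵀ) * V'.1 * (U.1ᵀ * V'.1)⁻¹ = N * T := by
    have e1 : 1 - U.1 * U.1ᵀ = N * Nᵀ := by rw [← h.add]; abel
    have e2 : Nᵀ * V'.1 = T * (U.1ᵀ * V'.1) := by
      rw [hVO, ← Matrix.mul_assoc, ← hT]; simp only [Matrix.mul_assoc]
    rw [e1, Matrix.mul_assoc N, e2, Matrix.mul_assoc, Matrix.mul_assoc,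
      Matrix.mul_nonsing_inv _ hWO, Matrix.mul_one]
  rw [hM] at hsvd
  rw [hΔ]
  refine hsvd.norm_arctan_sub_le.trans ?_
  rw [norm_isometry_mul h.right]

end LiftLog

/-! ### The reconstruction risk as a trace. -/

section Risk

variable {d k : ℕ}

theorem integrable_coord_mul {μ : Measure (EuclideanSpace ℝ (Fin d))}
    (hmom : Integrable (fun x => ‖x‖ ^ 2) μ) (a b : Fin d) :
    Integrable (fun x : EuclideanSpace ℝ (Fin d) => x a * x b) μ := by
  refine hmom.mono' (by fun_prop) (ae_of_all _ fun x => ?_)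
  rw [norm_mul, sq]
  exact mul_le_mul (PiLp.norm_apply_le x a) (PiLp.norm_apply_le x b) (norm_nonneg _) (norm_nonneg _)

theorem norm_sub_projection_sq (V : Stiefel d k) (x : EuclideanSpace ℝ (Fin d)) :
    ‖x - Matrix.toEuclideanLin (V.1 * V.1ᵀ) x‖ ^ 2 =
      ‖x‖ ^ 2 - ∑ a, ∑ b, (V.1 * V.1ᵀ) a b * (x a * x b) := by
  set p := Matrix.toEuclideanLin (V.1 * V.1ᵀ) with hp
  have h1 : inner ℝ x (p x) = ∑ a, ∑ b, (V.1 * V.1ᵀ) a b * (x a * x b) := by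
    simp only [hp, PiLp.inner_apply, RCLike.inner_apply, conj_trivial, Matrix.toLpLin_apply,
      Matrix.mulVec, dotProduct, Finset.sum_mul]
    exact Finset.sum_congr rfl fun a _ => Finset.sum_congr rfl fun b _ => by ring
  have h2 : inner ℝ (p x) (p x) = inner ℝ x (p x) := by
    have h3 := adjoint_comp_toEuclideanLin (V.1 * V.1ᵀ)
    have h4 : (V.1 * V.1ᵀ)ᵀ * (V.1 * V.1ᵀ) = V.1 * V.1ᵀ := by
      rw [Matrix.transpose_mul, Matrix.transpose_transpose, Matrix.mul_assoc,
        ← Matrix.mul_assoc V.1ᵀ, V.2, Matrix.one_mul]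
    rw [h4, ← hp] at h3
    rw [← LinearMap.adjoint_inner_right, ← LinearMap.comp_apply, h3]
  rw [← h1, norm_sub_sq_real, ← real_inner_self_eq_norm_sq (p x), h2]
  ring

/-- The risk is affine in the projector `V Vᵀ`; this yields both the trace formula for the excess
risk and the measurability of the risk. -/
theorem risk_mk {μ : Measure (EuclideanSpace ℝ (Fin d))}
    (hmom : Integrable (fun x => ‖x‖ ^ 2) μ) (V : Stiefel d k) :
    risk μ (Grassmannian.mk V) =
      1 / 2 * (∫ x, ‖x‖ ^ 2 ∂μ - (V.1 * V.1ᵀ * populationCov μ).trace) := by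
  change 1 / 2 * ∫ x, ‖x - Matrix.toEuclideanLin (V.1 * V.1ᵀ) x‖ ^ 2 ∂μ = _
  congr 1
  simp_rw [norm_sub_projection_sq]
  have hi : ∀ a b, Integrable (fun x : EuclideanSpace ℝ (Fin d) =>
      (V.1 * V.1ᵀ) a b * (x a * x b)) μ := fun a b => (integrable_coord_mul hmom a b).const_mul _
  rw [integral_sub hmom (integrable_finsetSum _ fun a _ => integrable_finsetSum _ fun b _ => hi a b),
    integral_finsetSum _ fun a _ => integrable_finsetSum _ fun b _ => hi a b]
  congr 1
  rw [Matrix.trace]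
  refine Finset.sum_congr rfl fun a _ => ?_
  rw [integral_finsetSum _ fun b _ => hi a b, Matrix.diag_apply, Matrix.mul_apply]
  refine Finset.sum_congr rfl fun b _ => ?_
  rw [integral_const_mul, populationCov, Matrix.of_apply]
  simp_rw [mul_comm]

theorem risk_sub_risk {μ : Measure (EuclideanSpace ℝ (Fin d))}
    (hmom : Integrable (fun x => ‖x‖ ^ 2) μ) (U V : Stiefel d k) :
    risk μ (Grassmannian.mk V) - risk μ (Grassmannian.mk U) =
      1 / 2 * ((U.1ᵀ * populationCov μ * U.1).trace - (V.1ᵀ * populationCov μ * V.1).trace) := by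
  have e : ∀ X : Stiefel d k, (X.1 * X.1ᵀ * populationCov μ).trace =
      (X.1ᵀ * populationCov μ * X.1).trace := fun X => by
    rw [Matrix.mul_assoc, Matrix.trace_mul_comm]
  rw [risk_mk hmom, risk_mk hmom, e, e]
  ring

end Risk

/-! ### Deterministic expansions for ordered eigenbases. -/

section Deterministic

variable {d k : ℕ}

/-- Dependence of the leading eigenspace on the matrix: continuity at a matrix with an eigengap. -/
theorem exists_grDist_leadingFrame_le (hk : 1 ≤ k) (hkd : k < d) {A : Matrix (Fin d) (Fin d) ℝ}
    {u : OrthonormalBasis (Fin d) ℝ (EuclideanSpace ℝ (Fin d))} {lam : Fin d → ℝ}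
    (hu : IsOrderedEigenbasis A u lam) {hk' : k - 1 < d} (hgap : lam ⟨k, hkd⟩ < lam ⟨k - 1, hk'⟩)
    {ε : ℝ} (hε : 0 < ε) :
    ∃ η : ℝ, 0 < η ∧ ∀ (B : Matrix (Fin d) (Fin d) ℝ)
      (u' : OrthonormalBasis (Fin d) ℝ (EuclideanSpace ℝ (Fin d))) (lam' : Fin d → ℝ),
      IsOrderedEigenbasis B u' lam' → ‖B - A‖ < η →
      grDist (Grassmannian.mk (leadingFrame hkd.le u'))
        (Grassmannian.mk (leadingFrame hkd.le u)) ≤ ε := by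
  obtain ⟨η, hη, h⟩ := exists_grDist_le d k hε
  have hg := sub_pos.2 hgap
  have hk0 : (0 : ℝ) < k := by exact_mod_cast hk
  -- Chosen so that gap · ‖Nᵀ V‖² ≤ 2k ‖B - A‖ forces ‖Nᵀ V‖² < η.
  refine ⟨(lam ⟨k - 1, hk'⟩ - lam ⟨k, hkd⟩) * η / (2 * k), by positivity, ?_⟩
  intro B u' lam' hu' hB
  refine h _ _ _ _ (isSplit_frames hkd.le u) (isSplit_frames hkd.le u') ?_
  have h1 := (isSplit_frames hkd.le u).perturbation (hu.mul_frame _) (hu.mul_frame _)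
    (hu.le_head hkd.le hk') (hu.tail_le hkd) (isSplit_frames hkd.le u') (hu'.mul_frame _)
    (hu'.mul_frame _) (hu'.le_head hkd.le hk')
    -- The threshold separating the spectrum of `B` is its own k-th largest eigenvalue, at index k -
    -- 1; ties with the next one are harmless.
    (fun i => (hu'.tail_le hkd i).trans (hu'.antitone (by
      change k - 1 ≤ k
      omega)))
  rw [Fintype.card_fin] at h1
  rw [lt_div_iff₀ (by positivity)] at hB
  exact lt_of_mul_lt_mul_left (by linarith) hg.le

/-- First-order expansion of the lifted logarithm and second-order expansion of the excess risk
at a matrix with an eigengap. -/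
theorem exists_liftLog_risk_expansion (hk : 1 ≤ k) (hkd : k < d)
    {μ : Measure (EuclideanSpace ℝ (Fin d))} (hmom : Integrable (fun x => ‖x‖ ^ 2) μ)
    {u : OrthonormalBasis (Fin d) ℝ (EuclideanSpace ℝ (Fin d))} {lam : Fin d → ℝ}
    (hu : IsOrderedEigenbasis (populationCov μ) u lam)
    {hk' : k - 1 < d} (hgap : lam ⟨k, hkd⟩ < lam ⟨k - 1, hk'⟩) :
    ∃ c ε : ℝ, 0 ≤ c ∧ 0 < ε ∧ ∀ (B : Matrix (Fin d) (Fin d) ℝ)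
      (u' : OrthonormalBasis (Fin d) ℝ (EuclideanSpace ℝ (Fin d))) (lam' : Fin d → ℝ),
      IsOrderedEigenbasis B u' lam' → ‖B - populationCov μ‖ ≤ ε →
      ∀ C : Matrix (Fin (d - k)) (Fin k) ℝ,
      C = (trailingFrame hkd.le u).1ᵀ * B * (leadingFrame hkd.le u).1 →
      (∀ D, ‖liftLog (leadingFrame hkd.le u) (Grassmannian.mk (leadingFrame hkd.le u')) D -
        (trailingFrame hkd.le u).1 * Matrix.of fun i j => C i j / gap hkd.le lam i j‖ ≤
          c * (‖C‖ * ‖B - populationCov μ‖)) ∧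
      |risk μ (Grassmannian.mk (leadingFrame hkd.le u')) -
        risk μ (Grassmannian.mk (leadingFrame hkd.le u)) -
        1 / 2 * ∑ i, ∑ j, C i j ^ 2 / gap hkd.le lam i j| ≤
          c * (‖C‖ ^ 2 * ‖B - populationCov μ‖) := by
  have : Nonempty (Fin k) := ⟨⟨0, hk⟩⟩
  obtain ⟨c, ε, hc, hε, h⟩ := (isSplit_frames hkd.le u).exists_expansion (hu.mul_frame _)
    (hu.mul_frame _) (hu.le_head hkd.le hk') (hu.tail_le hkd) hgap
  refine ⟨c, ε, hc, hε, ?_⟩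
  rintro B u' lam' hu' hB C rfl
  obtain ⟨T, hW, hT, h1, h2⟩ := h _ _ B _ _ _ (isSplit_frames hkd.le u') (hu'.mul_frame _)
    (hu'.mul_frame _) (hu'.le_head hkd.le hk')
    (fun i => (hu'.tail_le hkd i).trans (hu'.antitone (by
      change k - 1 ≤ k
      omega))) hB
  constructor
  · intro D
    refine le_trans ?_ h1
    have h3 := norm_liftLog_sub_le hkd.le (isSplit_frames hkd.le u) hW hT D
    refine (norm_sub_le_norm_sub_add_norm_sub _
      ((trailingFrame hkd.le u).1 * T) _).trans (add_le_add h3 ?_)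
    rw [← Matrix.mul_sub, norm_isometry_mul (trailingFrame hkd.le u).2]
    exact le_rfl
  · rw [risk_sub_risk hmom, ← mul_sub, abs_mul, abs_of_pos (by norm_num : (0 : ℝ) < 1 / 2)]
    have := abs_nonneg (((leadingFrame hkd.le u).1ᵀ * populationCov μ *
      (leadingFrame hkd.le u).1).trace - ((leadingFrame hkd.le u').1ᵀ * populationCov μ *
      (leadingFrame hkd.le u').1).trace - ∑ i, ∑ j, ((trailingFrame hkd.le u).1ᵀ * B *
      (leadingFrame hkd.le u).1) i j ^ 2 / gap hkd.le lam i j)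
    refine le_trans ?_ h2
    linarith!

end Deterministic

end PCA

namespace PCA

/-! ### Measurability of the risk and of the lifted logarithm. -/

section Measurability

instance instSecondCountableTopologyMatrix (m n : Type*) [Finite m] [Finite n] :
    SecondCountableTopology (Matrix m n ℝ) := by
  have := Fintype.ofFinite m
  have := Fintype.ofFinite n
  exact inferInstanceAs (SecondCountableTopology (m → n → ℝ))

instance instMetrizableSpaceMatrix (m n : Type*) [Finite m] [Finite n] :
    TopologicalSpace.MetrizableSpace (Matrix m n ℝ) := by
  have := Fintype.ofFinite m
  have := Fintype.ofFinite n
  exact inferInstanceAs (TopologicalSpace.MetrizableSpace (m → n → ℝ))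

theorem measurable_matrix_iff {α m n : Type*} [MeasurableSpace α] {f : α → Matrix m n ℝ} :
    Measurable f ↔ ∀ i j, Measurable fun x => f x i j := by
  constructor
  · intro h i j
    exact (measurable_pi_apply j).comp ((measurable_pi_apply i).comp h)
  · intro h
    exact measurable_pi_iff.2 fun i => measurable_pi_iff.2 fun j => h i j

/-- Inversion is discontinuous at singular matrices, but it is the adjugate times the inverse of the
determinant, and inversion on ℝ is measurable. -/
theorem measurable_matrix_inv {n : Type*} [Fintype n] [DecidableEq n] :
    Measurable fun X : Matrix n n ℝ => X⁻¹ := by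
  refine measurable_matrix_iff.2 fun i j => ?_
  have h1 : Continuous fun X : Matrix n n ℝ => X.det := continuous_id.matrix_det
  have h2 : Continuous fun X : Matrix n n ℝ => X.adjugate i j :=
    continuous_id.matrix_adjugate.matrix_elem i j
  simp only [Matrix.inv_def, Ring.inverse_eq_inv', Matrix.smul_apply, smul_eq_mul]
  exact h1.measurable.inv.mul h2.measurable

variable {d k : ℕ}

/-- The orthogonal projector `U Uᵀ` onto the subspace `[U]`. -/
def projector (p : Grassmannian d k) : Matrix (Fin d) (Fin d) ℝ :=
  Quotient.liftOn (s := stiefelSetoid d k) p (fun U => U.1 * U.1ᵀ) (by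
    rintro U V ⟨Q, hQ, h⟩
    have h1 : Q * Qᵀ = 1 := (Matrix.mem_orthogonalGroup_iff (Fin k) ℝ).1 hQ
    rw [h, Matrix.transpose_mul, Matrix.mul_assoc, ← Matrix.mul_assoc Q, h1, Matrix.one_mul])

/-- The projector is continuous for the quotient topology, so measurability statements on the
Grassmannian reduce to functions of `U Uᵀ`. -/
theorem measurable_projector : Measurable (projector : Grassmannian d k → _) := by
  have h : Continuous fun U : Stiefel d k => U.1 * U.1ᵀ := by
    have : Continuous fun U : Stiefel d k => U.1 := continuous_subtype_val
    exact this.matrix_mul this.matrix_transpose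
  have hc : Continuous (projector : Grassmannian d k → _) :=
    h.quotient_lift (s := stiefelSetoid d k) _
  exact hc.measurable

theorem measurable_risk {μ : Measure (EuclideanSpace ℝ (Fin d))}
    (hmom : Integrable (fun x => ‖x‖ ^ 2) μ) :
    Measurable (risk μ : Grassmannian d k → ℝ) := by
  have h : risk μ = fun p : Grassmannian d k =>
      1 / 2 * (∫ x, ‖x‖ ^ 2 ∂μ - (projector p * populationCov μ).trace) := by
    funext p
    obtain ⟨V, rfl⟩ : ∃ V : Stiefel d k, Grassmannian.mk V = p := Quotient.exists_rep p
    exact risk_mk hmom V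
  have h2 : Continuous fun X : Matrix (Fin d) (Fin d) ℝ =>
      1 / 2 * (∫ x, ‖x‖ ^ 2 ∂μ - (X * populationCov μ).trace) := by
    have := (continuous_id.matrix_mul continuous_const :
      Continuous fun X : Matrix (Fin d) (Fin d) ℝ => X * populationCov μ).matrix_trace
    fun_prop
  rw [h]
  exact h2.measurable.comp measurable_projector

/-- arctan x = x h(x²) with h continuous, and Weierstrass approximates h on [0, n] to within 1/(n +
1). Applied to singular values, this expresses the logarithm as a limit of `M * p (Mᵀ * M)` and
avoids a measurable choice of decompositions. -/
theorem exists_polynomial_tendsto_arctan : ∃ p : ℕ → Polynomial ℝ, ∀ x : ℝ, 0 ≤ x →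
    Tendsto (fun n => x * (p n).eval (x * x)) atTop (𝓝 (Real.arctan x)) := by
  set h : ℝ → ℝ := fun y => dslope Real.arctan 0 √y with hh
  have hc : Continuous h := by
    have h1 : ContinuousOn (dslope Real.arctan 0) Set.univ :=
      (continuousOn_dslope Filter.univ_mem).2
        ⟨Real.continuous_arctan.continuousOn, Real.differentiable_arctan 0⟩
    exact (continuousOn_univ.1 h1).comp Real.continuous_sqrt
  choose p hp using fun n : ℕ => exists_polynomial_near_of_continuousOn 0 n h hc.continuousOn
    (1 / ((n : ℝ) + 1)) Nat.one_div_pos_of_nat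
  refine ⟨p, fun x hx => ?_⟩
  have e : Real.arctan x = x * h (x * x) := by
    have := sub_smul_dslope Real.arctan 0 x
    simp only [sub_zero, smul_eq_mul, Real.arctan_zero] at this
    rw [hh]
    simp only [Real.sqrt_mul_self hx, this]
  rw [e]
  refine Tendsto.const_mul x ?_
  rw [tendsto_iff_dist_tendsto_zero]
  refine squeeze_zero' (Eventually.of_forall fun _ => dist_nonneg) ?_
    tendsto_one_div_add_atTop_nhds_zero_nat
  filter_upwards [eventually_ge_atTop ⌈x * x⌉₊] with n hn
  rw [Real.dist_eq]
  exact (hp n _ ⟨mul_self_nonneg x, Nat.ceil_le.1 hn⟩).le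

/-- `(I - U Uᵀ) V (Uᵀ V)⁻¹` as a function of the projector `V Vᵀ`. -/
def tangentMap (U : Stiefel d k) (Pi : Matrix (Fin d) (Fin d) ℝ) : Matrix (Fin d) (Fin k) ℝ :=
  (1 - U.1 * U.1ᵀ) * Pi * U.1 * (U.1ᵀ * Pi * U.1)⁻¹

/-- A factor `(Uᵀ V)ᵀ` cancels against its inverse, so the matrix defining the logarithm depends on
the projector only. -/
theorem tangentMap_projector (U V : Stiefel d k) (hW : IsUnit (U.1ᵀ * V.1).det) :
    tangentMap U (V.1 * V.1ᵀ) = (1 - U.1 * U.1ᵀ) * V.1 * (U.1ᵀ * V.1)⁻¹ := by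
  have e1 : U.1ᵀ * (V.1 * V.1ᵀ) * U.1 = U.1ᵀ * V.1 * (U.1ᵀ * V.1)ᵀ := by
    simp only [Matrix.transpose_mul, Matrix.transpose_transpose, Matrix.mul_assoc]
  have e2 : (1 - U.1 * U.1ᵀ) * (V.1 * V.1ᵀ) * U.1 =
      (1 - U.1 * U.1ᵀ) * V.1 * (U.1ᵀ * V.1)ᵀ := by
    simp only [Matrix.transpose_mul, Matrix.transpose_transpose, Matrix.mul_assoc]
  rw [tangentMap, e1, e2, Matrix.mul_inv_rev, Matrix.mul_assoc _ (U.1ᵀ * V.1)ᵀ,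
    ← Matrix.mul_assoc (U.1ᵀ * V.1)ᵀ, Matrix.mul_nonsing_inv _ (by rwa [Matrix.det_transpose]),
    Matrix.one_mul]

theorem logDefined_iff_det (U : Stiefel d k) (p : Grassmannian d k) :
    LogDefined (Grassmannian.mk U) p ↔ (U.1ᵀ * projector p * U.1).det ≠ 0 := by
  obtain ⟨V, rfl⟩ : ∃ V : Stiefel d k, Grassmannian.mk V = p := Quotient.exists_rep p
  have e : (U.1ᵀ * projector (Grassmannian.mk V) * U.1).det = (U.1ᵀ * V.1).det ^ 2 := by
    have : U.1ᵀ * projector (Grassmannian.mk V) * U.1 = U.1ᵀ * V.1 * (U.1ᵀ * V.1)ᵀ := by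
      change U.1ᵀ * (V.1 * V.1ᵀ) * U.1 = _
      simp only [Matrix.transpose_mul, Matrix.transpose_transpose, Matrix.mul_assoc]
    rw [this, Matrix.det_mul, Matrix.det_transpose, sq]
  rw [logDefined_mk_iff, e, isUnit_iff_ne_zero, ne_eq, ne_eq, pow_eq_zero_iff two_ne_zero]

theorem tendsto_liftLog (hkd : k ≤ d) {p : ℕ → Polynomial ℝ}
    (hp : ∀ x : ℝ, 0 ≤ x → Tendsto (fun n => x * (p n).eval (x * x)) atTop (𝓝 (Real.arctan x)))
    (U : Stiefel d k) (q : Grassmannian d k) (D : Matrix (Fin d) (Fin k) ℝ)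
    (h : LogDefined (Grassmannian.mk U) q) :
    Tendsto (fun n => tangentMap U (projector q) *
      Polynomial.aeval ((tangentMap U (projector q))ᵀ * tangentMap U (projector q)) (p n))
      atTop (𝓝 (liftLog U q D)) := by
  obtain ⟨V, rfl, P, s, Q, hsvd, hΔ⟩ := liftLog_spec hkd U q D h
  have e : tangentMap U (projector (Grassmannian.mk V)) =
      (1 - U.1 * U.1ᵀ) * V.1 * (U.1ᵀ * V.1)⁻¹ :=
    tangentMap_projector U V ((logDefined_mk_iff U V).1 h)
  rw [← e] at hsvd
  simp_rw [hsvd.mul_aeval]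
  rw [hΔ]
  have h1 : Tendsto (fun n j => s j * (p n).eval (s j * s j)) atTop
      (𝓝 fun j => Real.arctan (s j)) := tendsto_pi_nhds.2 fun j => hp _ (hsvd.nonneg j)
  have h2 : Continuous fun t : Fin k → ℝ => P * Matrix.diagonal t * Qᵀ :=
    (continuous_const.matrix_mul continuous_id.matrix_diagonal).matrix_mul continuous_const
  exact (h2.tendsto _).comp h1

theorem measurable_tangentMap (U : Stiefel d k) : Measurable (tangentMap U) := by
  have h1 : Continuous fun X : Matrix (Fin d) (Fin d) ℝ => U.1ᵀ * X * U.1 :=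
    (continuous_const.matrix_mul continuous_id).matrix_mul continuous_const
  have h2 : Continuous fun X : Matrix (Fin d) (Fin d) ℝ => (1 - U.1 * U.1ᵀ) * X * U.1 :=
    (continuous_const.matrix_mul continuous_id).matrix_mul continuous_const
  have h3 : Continuous fun X : Matrix (Fin d) (Fin k) ℝ × Matrix (Fin k) (Fin k) ℝ => X.1 * X.2 :=
    continuous_fst.matrix_mul continuous_snd
  exact h3.measurable.comp (h2.measurable.prodMk (measurable_matrix_inv.comp h1.measurable))

/-- On the Borel set where a determinant in the projector is nonzero, the logarithm is a pointwise
limit of measurable polynomial expressions in the tangent matrix; elsewhere it is the given value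
`D`. -/
theorem aemeasurable_liftLog (hkd : k ≤ d) {Ω : Type*} [MeasurableSpace Ω] {P : Measure Ω}
    (U : Stiefel d k) {q : Ω → Grassmannian d k} (hq : AEMeasurable q P)
    {D : Ω → Matrix (Fin d) (Fin k) ℝ} (hD : AEMeasurable D P) :
    AEMeasurable (fun ω => liftLog U (q ω) (D ω)) P := by
  classical
  obtain ⟨p, hp⟩ := exists_polynomial_tendsto_arctan
  have hdet : Measurable fun q : Grassmannian d k => (U.1ᵀ * projector q * U.1).det :=
    ((continuous_const.matrix_mul continuous_id).matrix_mul continuous_const :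
      Continuous fun X : Matrix (Fin d) (Fin d) ℝ => U.1ᵀ * X * U.1).matrix_det.measurable.comp
      measurable_projector
  have hset : MeasurableSet {q : Grassmannian d k | LogDefined (Grassmannian.mk U) q} := by
    simp_rw [logDefined_iff_det]
    exact (hdet (measurableSet_singleton 0)).compl
  have hF : ∀ n, Measurable fun q : Grassmannian d k => tangentMap U (projector q) *
      Polynomial.aeval ((tangentMap U (projector q))ᵀ * tangentMap U (projector q)) (p n) := by
    intro n
    have hc : Continuous fun M : Matrix (Fin d) (Fin k) ℝ =>
        M * Polynomial.aeval (Mᵀ * M) (p n) :=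
      continuous_id.matrix_mul ((Polynomial.continuous_aeval (p n)).comp
        (continuous_id.matrix_transpose.matrix_mul continuous_id))
    exact hc.measurable.comp ((measurable_tangentMap U).comp measurable_projector)
  have hpair : ∀ n, Measurable fun z : Grassmannian d k × Matrix (Fin d) (Fin k) ℝ =>
      if LogDefined (Grassmannian.mk U) z.1 then tangentMap U (projector z.1) *
        Polynomial.aeval ((tangentMap U (projector z.1))ᵀ * tangentMap U (projector z.1)) (p n)
      else z.2 := fun n =>
    Measurable.ite (measurable_fst hset) ((hF n).comp measurable_fst) measurable_snd
  have hlim : Measurable fun z : Grassmannian d k × Matrix (Fin d) (Fin k) ℝ =>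
      liftLog U z.1 z.2 := by
    refine measurable_of_tendsto_metrizable hpair (tendsto_pi_nhds.2 fun z => ?_)
    by_cases h : LogDefined (Grassmannian.mk U) z.1
    · simp only [h, if_true]
      exact tendsto_liftLog hkd hp U z.1 z.2 h
    · simp only [h, if_false, liftLog]
      exact tendsto_const_nhds
  exact hlim.comp_aemeasurable (hq.prodMk hD)

end Measurability

end PCA

namespace PCA

/-! ### Slutsky-type lemmas. -/

section Slutsky

/-- The deterministic expansions hold only near Σ; the event that Σ_n is farther away has vanishing
probability. -/
theorem tendsto_measure_of_forall_imp {Ω : Type*} [MeasurableSpace Ω] {P : Measure Ω}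
    {e : ℕ → Ω → ℝ} {f g : ℕ → Ω → ℝ} {η ε : ℝ} (hη : 0 < η)
    (he : TendstoInMeasure P e atTop fun _ => 0)
    (hfg : ∀ n ω, |e n ω| ≤ η → f n ω ≤ g n ω)
    (hg : Tendsto (fun n => P {ω | ε ≤ g n ω}) atTop (𝓝 0)) :
    Tendsto (fun n => P {ω | ε ≤ f n ω}) atTop (𝓝 0) := by
  have h1 := tendstoInMeasure_iff_norm.1 he η hη
  have h2 := h1.add hg
  rw [add_zero] at h2
  refine tendsto_of_tendsto_of_tendsto_of_le_of_le tendsto_const_nhds h2 (fun _ => zero_le) ?_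
  intro n
  refine (measure_mono ?_).trans (measure_union_le _ _)
  intro ω hω
  by_cases h : |e n ω| ≤ η
  · exact Or.inr (le_trans hω (hfg n ω h))
  · left
    simp only [sub_zero, Real.norm_eq_abs]
    exact (not_le.1 h).le

variable {Ω Ω' : Type*} [MeasurableSpace Ω] {P : Measure Ω} [IsProbabilityMeasure P]
  [MeasurableSpace Ω'] {P' : Measure Ω'} [IsProbabilityMeasure P']

/-- The pair (X_n, e_n) converges jointly to (Z, 0), so by continuous mapping the product converges
in law to 0; the portmanteau inequality on the closed half-line [ε, ∞) concludes. -/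
theorem tendsto_measure_const_mul_norm_pow_mul {E : Type*} [NormedAddCommGroup E]
    [MeasurableSpace E] [BorelSpace E] [SecondCountableTopology E] {X : ℕ → Ω → E} {Z : Ω' → E}
    {e : ℕ → Ω → ℝ} (hX : TendstoInDistribution X atTop Z (fun _ => P) P')
    (he : TendstoInMeasure P e atTop fun _ => 0) (hem : ∀ n, AEMeasurable (e n) P)
    (c : ℝ) (r : ℕ) {ε : ℝ} (hε : 0 < ε) :
    Tendsto (fun n => P {ω | ε ≤ c * (‖X n ω‖ ^ r * e n ω)}) atTop (𝓝 0) := by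
  have h := hX.continuous_comp_prodMk_of_tendstoInMeasure_const
    (g := fun z : E × ℝ => c * (‖z.1‖ ^ r * z.2)) (by fun_prop) he hem
  have h1 := ProbabilityMeasure.limsup_measure_closed_le_of_tendsto h.tendsto
    (isClosed_Ici (a := ε))
  have h2 : P'.map (fun ω => c * (‖Z ω‖ ^ r * (0 : ℝ))) (Set.Ici ε) = 0 := by
    simp only [mul_zero]
    rw [Measure.map_apply measurable_const measurableSet_Ici]
    have : (fun _ : Ω' => (0 : ℝ)) ⁻¹' Set.Ici ε = ∅ := by
      ext ω; simp [hε]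
    rw [this, measure_empty]
  simp only [ProbabilityMeasure.coe_mk] at h1
  rw [h2] at h1
  have h3 : ∀ n, P.map (fun ω => c * (‖X n ω‖ ^ r * e n ω)) (Set.Ici ε) =
      P {ω | ε ≤ c * (‖X n ω‖ ^ r * e n ω)} := fun n => by
    rw [Measure.map_apply_of_aemeasurable (h.forall_aemeasurable n) measurableSet_Ici]
    rfl
  simp only [h3] at h1
  exact tendsto_of_le_liminf_of_limsup_le zero_le h1

/-- Convergence in law sees only the law of the limit; this moves the limit from a Gaussian vector
to the matrix law `ν`. -/
theorem tendstoInDistribution_of_map_eq {Ω'' E : Type*} [MeasurableSpace Ω''] {P'' : Measure Ω''}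
    [IsProbabilityMeasure P''] [TopologicalSpace E] [MeasurableSpace E] [OpensMeasurableSpace E]
    {X : ℕ → Ω → E} {Z : Ω' → E} {W : Ω'' → E}
    (hX : TendstoInDistribution X atTop Z (fun _ => P) P') (hW : AEMeasurable W P'')
    (h : P'.map Z = P''.map W) : TendstoInDistribution X atTop W (fun _ => P) P'' where
  forall_aemeasurable := hX.forall_aemeasurable
  aemeasurable_limit := hW
  tendsto := by
    have e : (⟨P'.map Z, Measure.isProbabilityMeasure_map hX.aemeasurable_limit⟩ :
        ProbabilityMeasure E) = ⟨P''.map W, Measure.isProbabilityMeasure_map hW⟩ := Subtype.ext h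
    rw [← e]
    exact hX.tendsto

open scoped Matrix.Norms.Frobenius in
theorem tendstoInDistribution_matrix_of_tendsto_measure_norm_sub {m n : Type*} [Fintype m]
    [Fintype n] {X Y : ℕ → Ω → Matrix m n ℝ} {Z : Ω' → Matrix m n ℝ}
    (hX : TendstoInDistribution X atTop Z (fun _ => P) P')
    (hY : ∀ i, AEMeasurable (Y i) P)
    (h : ∀ ε : ℝ, 0 < ε → Tendsto (fun i => P {ω | ε ≤ ‖Y i ω - X i ω‖}) atTop (𝓝 0)) :
    TendstoInDistribution Y atTop Z (fun _ => P) P' := by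
  have hXY : TendstoInMeasure P (Y - X) atTop 0 := by
    refine tendstoInMeasure_iff_norm.2 fun ε hε => ?_
    simpa using h ε hε
  exact @tendstoInDistribution_of_tendstoInMeasure_sub ℕ (Matrix m n ℝ) Ω' Ω _ P' _ _ P _ _ atTop
    Matrix.frobeniusSeminormedAddCommGroup (instSecondCountableTopologyMatrix m n)
    (instBorelSpaceMatrix m n) X _ Y Z hX hXY hY

theorem tendstoInDistribution_real_of_tendsto_measure {X Y : ℕ → Ω → ℝ} {Z : Ω' → ℝ}
    (hX : TendstoInDistribution X atTop Z (fun _ => P) P')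
    (hY : ∀ i, AEMeasurable (Y i) P)
    (h : ∀ ε : ℝ, 0 < ε → Tendsto (fun i => P {ω | ε ≤ |Y i ω - X i ω|}) atTop (𝓝 0)) :
    TendstoInDistribution Y atTop Z (fun _ => P) P' := by
  refine tendstoInDistribution_of_tendstoInMeasure_sub Y Z hX ?_ hY
  refine tendstoInMeasure_iff_norm.2 fun ε hε => ?_
  simpa using h ε hε

end Slutsky

/-! ### The multivariate central limit theorem. -/

section CentralLimit

theorem integrable_mul_coord {Ω ι : Type*} [MeasurableSpace Ω] {P : Measure Ω}
    {ξ : Ω → EuclideanSpace ℝ ι}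
    (h2 : ∀ i, MemLp (fun ω => ξ ω i) 2 P) (i j : ι) :
    Integrable (fun ω => ξ ω i * ξ ω j) P := (h2 i).integrable_mul (h2 j)

variable {Ω : Type*} [MeasurableSpace Ω] {P : Measure Ω} [IsProbabilityMeasure P]
  {ι : Type*} [Fintype ι]

theorem integral_sq_inner {Ω : Type*} [MeasurableSpace Ω] {P : Measure Ω}
    {ξ : Ω → EuclideanSpace ℝ ι}
    (h2 : ∀ i, MemLp (fun ω => ξ ω i) 2 P) (x : ι → ℝ) :
    ∫ ω, (∑ i, x i * ξ ω i) ^ 2 ∂P =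
      x ⬝ᵥ (Matrix.of fun i j => ∫ ω, ξ ω i * ξ ω j ∂P) *ᵥ x := by
  have hi : ∀ i j, Integrable (fun ω => x i * ξ ω i * (x j * ξ ω j)) P := fun i j => by
    have := (integrable_mul_coord h2 i j).const_mul (x i * x j)
    refine this.congr (ae_of_all _ fun ω => ?_)
    ring
  simp_rw [sq, Finset.sum_mul_sum]
  rw [integral_finsetSum _ fun i _ => integrable_finsetSum _ fun j _ => hi i j]
  simp only [dotProduct, Matrix.mulVec, Matrix.of_apply, Finset.mul_sum]
  refine Finset.sum_congr rfl fun i _ => ?_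
  rw [integral_finsetSum _ fun j _ => hi i j]
  refine Finset.sum_congr rfl fun j _ => ?_
  rw [← integral_mul_const, ← integral_const_mul]
  exact integral_congr_ae (ae_of_all _ fun ω => by ring)

theorem posSemidef_secondMoment {Ω : Type*} [MeasurableSpace Ω] {P : Measure Ω}
    {ξ : Ω → EuclideanSpace ℝ ι}
    (h2 : ∀ i, MemLp (fun ω => ξ ω i) 2 P) :
    (Matrix.of fun i j => ∫ ω, ξ ω i * ξ ω j ∂P : Matrix ι ι ℝ).PosSemidef := by
  refine Matrix.PosSemidef.of_dotProduct_mulVec_nonneg ?_ fun x => ?_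
  · ext i j
    simp [mul_comm]
  · rw [star_trivial, ← integral_sq_inner h2]
    exact integral_nonneg fun ω => sq_nonneg _

/-- The multivariate central limit theorem for centred random vectors. -/
theorem tendstoInDistribution_multivariateGaussian [DecidableEq ι]
    {ξ : ℕ → Ω → EuclideanSpace ℝ ι} (hindep : iIndepFun ξ P)
    (hident : ∀ n, IdentDistrib (ξ n) (ξ 0) P P) (h2 : ∀ i, MemLp (fun ω => ξ 0 ω i) 2 P)
    (h0 : ∀ i, ∫ ω, ξ 0 ω i ∂P = 0) :
    TendstoInDistribution (fun (n : ℕ) ω => (√(n : ℝ))⁻¹ • ∑ l ∈ Finset.range n, ξ l ω) atTop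
      (fun y => y) (fun _ => P)
      (multivariateGaussian 0 (Matrix.of fun i j => ∫ ω, ξ 0 ω i * ξ 0 ω j ∂P)) where
  forall_aemeasurable n :=
    (measurable_const_smul _).comp_aemeasurable
      (Finset.aemeasurable_fun_sum _ fun l _ => (hident l).aemeasurable_fst)
  aemeasurable_limit := aemeasurable_id'
  tendsto := by
    have hm : ∀ l, AEMeasurable (ξ l) P := fun l => (hident l).aemeasurable_fst
    have hmn : ∀ n : ℕ, AEMeasurable (fun ω => (√(n : ℝ))⁻¹ • ∑ l ∈ Finset.range n, ξ l ω) P :=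
      fun n => (measurable_const_smul _).comp_aemeasurable
        (Finset.aemeasurable_fun_sum _ fun l _ => hm l)
    have hS := posSemidef_secondMoment h2
    refine ProbabilityMeasure.tendsto_iff_tendsto_charFun.2 fun t => ?_
    simp only [ProbabilityMeasure.coe_mk, Measure.map_id']
    rw [charFun_multivariateGaussian hS, ← integral_sq_inner h2]
    -- reduction to the one-dimensional theorem
    have hφ : Measurable fun y : EuclideanSpace ℝ ι => ∑ i, t i * y i := by fun_prop
    set X : ℕ → Ω → ℝ := fun l ω => ∑ i, t i * ξ l ω i with hX
    have hXL : MemLp (X 0) 2 P := memLp_finsetSum _ fun i _ => (h2 i).const_mul (t i)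
    have hX0 : P[X 0] = 0 := by
      rw [hX]
      simp only
      rw [integral_finsetSum _ fun i _ => ((h2 i).integrable one_le_two).const_mul _]
      simp [integral_const_mul, h0]
    have hclt := tendstoInDistribution_inv_sqrt_mul_sum_sub (P := P) (X := X)
      (Y := fun y : ℝ => y) (P' := gaussianReal 0 Var[X 0; P].toNNReal)
      ⟨aemeasurable_id', Measure.map_id'⟩ hXL (hindep.comp _ fun _ => hφ)
      (fun l => (hident l).comp hφ)
    -- Cramér–Wold: the vector `t` is absorbed into the scalar variables, so the characteristic
    -- function of the vector sum at `t` is that of the scalar sum at 1.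
    have hc := ProbabilityMeasure.tendsto_iff_tendsto_charFun.1 hclt.tendsto 1
    simp only [ProbabilityMeasure.coe_mk, Measure.map_id'] at hc
    rw [charFun_gaussianReal, Real.coe_toNNReal _ (variance_nonneg _ _),
      variance_of_integral_eq_zero hXL.aemeasurable hX0] at hc
    convert hc using 1
    · funext n
      rw [charFun_apply, charFun_apply_real, integral_map (hmn n) (by fun_prop),
        integral_map (hclt.forall_aemeasurable n) (by fun_prop)]
      refine integral_congr_ae (ae_of_all _ fun ω => ?_)
      have : inner ℝ ((√(n : ℝ))⁻¹ • ∑ l ∈ Finset.range n, ξ l ω) t =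
          (√(n : ℝ))⁻¹ * (∑ l ∈ Finset.range n, X l ω - n * P[X 0]) := by
        rw [hX0, mul_zero, sub_zero, inner_smul_left, sum_inner]
        simp [hX, PiLp.inner_apply]
      simp only [this]
      simp
    · congr 2
      simp [hX]

end CentralLimit

end PCA

namespace PCA

/-! ### Gaussian matrices with prescribed second moments. -/

section GaussianMatrix

variable {m n : ℕ}

/-- The linear map sending a vector to the matrix of its weighted coordinates. -/
def weightedMatrix (w : Fin m → Fin n → ℝ) :
    EuclideanSpace ℝ (Fin m × Fin n) →L[ℝ] Matrix (Fin m) (Fin n) ℝ where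
  toFun y := Matrix.of fun i j => w i j * y (i, j)
  map_add' x y := by ext; simp [mul_add]
  map_smul' c x := by ext; simp [mul_left_comm]
  cont := continuous_matrix fun i j => by
    simp only [Matrix.of_apply]
    fun_prop

theorem weightedMatrix_apply (w : Fin m → Fin n → ℝ) (y : EuclideanSpace ℝ (Fin m × Fin n))
    (i : Fin m) (j : Fin n) : weightedMatrix w y i j = w i j * y (i, j) := rfl

/-- Both limit laws are such linear images: the weights are 1/δ for the logarithm and 1/√δ for the
excess risk. -/
theorem isCenteredGaussianMatrix_map (w : Fin m → Fin n → ℝ)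
    {S : Matrix (Fin m × Fin n) (Fin m × Fin n) ℝ} (hS : S.PosSemidef) :
    IsCenteredGaussianMatrix ((multivariateGaussian 0 S).map (weightedMatrix w))
      fun i j s t => w i j * w s t * S (i, j) (s, t) := by
  have hmeas : Measurable (weightedMatrix w) := (weightedMatrix w).continuous.measurable
  have hentry : ∀ i j, Measurable fun G : Matrix (Fin m) (Fin n) ℝ => G i j := fun i j =>
    measurable_matrix_iff.1 measurable_id i j
  have hmean : ∀ p, ∫ y : EuclideanSpace ℝ (Fin m × Fin n), y p ∂(multivariateGaussian 0 S) = 0 :=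
    fun p => by
      have h := (measurePreserving_eval_multivariateGaussian (μ := 0) hS (i := p)).map_eq
      have h2 := integral_map (μ := multivariateGaussian 0 S)
        (φ := fun y : EuclideanSpace ℝ (Fin m × Fin n) => y p) (f := fun z : ℝ => z)
        (by fun_prop) (by fun_prop)
      rw [← h2, h, integral_id_gaussianReal]
      rfl
  have hL2 : ∀ p, MemLp (fun y : EuclideanSpace ℝ (Fin m × Fin n) => y p) 2
      (multivariateGaussian 0 S) := fun p =>
    IsGaussian.memLp_dual (multivariateGaussian 0 S) (EuclideanSpace.proj p) 2 (by simp)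
  refine ⟨isGaussian_map_of_measurable hmeas, fun i j => ?_, fun i j s t => ?_⟩
  · rw [integral_map hmeas.aemeasurable (hentry i j).aestronglyMeasurable]
    simp only [weightedMatrix_apply]
    rw [integral_const_mul, hmean, mul_zero]
  · have hprod : Measurable fun G : Matrix (Fin m) (Fin n) ℝ => G i j * G s t :=
      (hentry i j).mul (hentry s t)
    rw [integral_map hmeas.aemeasurable hprod.aestronglyMeasurable]
    have h := covariance_eval_multivariateGaussian (μ := 0) hS (i, j) (s, t)
    rw [covariance_eq_sub (hL2 _) (hL2 _), hmean, zero_mul, sub_zero] at h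
    rw [← h, ← integral_const_mul]
    refine integral_congr_ae (ae_of_all _ fun y => ?_)
    simp only [weightedMatrix_apply, Pi.mul_apply]
    ring

end GaussianMatrix

/-! ### Limit theorems for the empirical second-moment matrix. -/

section Sample

open scoped Matrix.Norms.Frobenius

variable {d k : ℕ} {Ω : Type*} [MeasurableSpace Ω] {P : Measure Ω}
  {μ : Measure (EuclideanSpace ℝ (Fin d))} {X : ℕ → Ω → EuclideanSpace ℝ (Fin d)}

theorem identDistrib_of_hasLaw (hlaw : ∀ i, HasLaw (X i) μ P) (n : ℕ) :
    IdentDistrib (X n) (X 0) P P :=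
  ⟨(hlaw n).aemeasurable, (hlaw 0).aemeasurable, by rw [(hlaw n).map_eq, (hlaw 0).map_eq]⟩

theorem integral_comp_of_hasLaw (hlaw : ∀ i, HasLaw (X i) μ P) {f : EuclideanSpace ℝ (Fin d) → ℝ}
    (hf : Measurable f) : ∫ ω, f (X 0 ω) ∂P = ∫ x, f x ∂μ := by
  rw [← (hlaw 0).map_eq, integral_map (hlaw 0).aemeasurable hf.aestronglyMeasurable]

theorem integrable_comp_of_hasLaw (hlaw : ∀ i, HasLaw (X i) μ P)
    {f : EuclideanSpace ℝ (Fin d) → ℝ} (hf : Measurable f) (hi : Integrable f μ) :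
    Integrable (fun ω => f (X 0 ω)) P := by
  rw [← (hlaw 0).map_eq] at hi
  exact (integrable_map_measure hf.aestronglyMeasurable (hlaw 0).aemeasurable).1 hi

theorem empiricalCov_apply (x : ℕ → EuclideanSpace ℝ (Fin d)) (n : ℕ) (a b : Fin d) :
    empiricalCov x n a b = (n : ℝ)⁻¹ * ∑ i ∈ Finset.range n, x i a * x i b := by
  simp [empiricalCov, Matrix.sum_apply]

theorem aemeasurable_empiricalCov (hlaw : ∀ i, HasLaw (X i) μ P) (n : ℕ) :
    AEMeasurable (fun ω => empiricalCov (fun i => X i ω) n) P := by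
  have h : Measurable fun x : Fin n → EuclideanSpace ℝ (Fin d) =>
      (Matrix.of fun a b => (n : ℝ)⁻¹ * ∑ i, x i a * x i b : Matrix (Fin d) (Fin d) ℝ) :=
    measurable_matrix_iff.2 fun a b => by
      simp only [Matrix.of_apply]
      fun_prop
  have h2 := h.comp_aemeasurable (aemeasurable_pi_lambda (fun ω (i : Fin n) => X i ω)
    fun i => (hlaw i).aemeasurable)
  refine h2.congr (ae_of_all _ fun ω => ?_)
  ext a b
  simp only [Function.comp_apply, Matrix.of_apply, empiricalCov_apply]
  rw [Finset.sum_range fun i => X i ω a * X i ω b]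

/-- Matrices carry the entrywise topology here, so the Frobenius norm is written out in entries. -/
theorem continuous_norm_sub_matrix (A : Matrix (Fin d) (Fin d) ℝ) :
    Continuous fun B : Matrix (Fin d) (Fin d) ℝ => ‖B - A‖ := by
  have : ∀ B : Matrix (Fin d) (Fin d) ℝ, ‖B - A‖ = √(∑ i, ∑ j, (B i j - A i j) ^ 2) := fun B => by
    rw [← Real.sqrt_sq (norm_nonneg (B - A)), frobenius_norm_sq]
    rfl
  simp_rw [this]
  refine Real.continuous_sqrt.comp (continuous_finsetSum _ fun i _ =>
    continuous_finsetSum _ fun j _ => ?_)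
  exact ((continuous_id.matrix_elem i j).sub continuous_const).pow 2

theorem aemeasurable_norm_empiricalCov_sub (hlaw : ∀ i, HasLaw (X i) μ P) (n : ℕ)
    (A : Matrix (Fin d) (Fin d) ℝ) :
    AEMeasurable (fun ω => ‖empiricalCov (fun i => X i ω) n - A‖) P :=
  (continuous_norm_sub_matrix A).measurable.comp_aemeasurable (aemeasurable_empiricalCov hlaw n)

/-- The law of large numbers for the empirical second-moment matrix. -/
theorem tendstoInMeasure_norm_empiricalCov_sub [IsProbabilityMeasure P] (hindep : iIndepFun X P)
    (hlaw : ∀ i, HasLaw (X i) μ P) (hmom : Integrable (fun x => ‖x‖ ^ 2) μ) :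
    TendstoInMeasure P (fun n ω => ‖empiricalCov (fun i => X i ω) n - populationCov μ‖) atTop
      fun _ => 0 := by
  refine tendstoInMeasure_of_tendsto_ae
    (fun n => (aemeasurable_norm_empiricalCov_sub hlaw n _).aestronglyMeasurable) ?_
  have hentry : ∀ a b : Fin d, ∀ᵐ ω ∂P, Tendsto
      (fun n : ℕ => empiricalCov (fun i => X i ω) n a b) atTop (𝓝 (populationCov μ a b)) := by
    intro a b
    have hf : Measurable fun x : EuclideanSpace ℝ (Fin d) => x a * x b := by fun_prop
    have h := strong_law_ae_real (fun l ω => X l ω a * X l ω b)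
      (integrable_comp_of_hasLaw hlaw hf (integrable_coord_mul hmom a b))
      (fun i j hij => (hindep.indepFun hij).comp hf hf)
      (fun l => (identDistrib_of_hasLaw hlaw l).comp hf)
    filter_upwards [h] with ω hω
    have e : P[fun ω => X 0 ω a * X 0 ω b] = populationCov μ a b :=
      integral_comp_of_hasLaw hlaw hf
    rw [e] at hω
    refine hω.congr fun n => ?_
    rw [empiricalCov_apply, div_eq_inv_mul]
  have hall : ∀ᵐ ω ∂P, ∀ a b, Tendsto
      (fun n : ℕ => empiricalCov (fun i => X i ω) n a b) atTop (𝓝 (populationCov μ a b)) :=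
    ae_all_iff.2 fun a => ae_all_iff.2 fun b => hentry a b
  filter_upwards [hall] with ω hω
  have h1 : Tendsto (fun n : ℕ => empiricalCov (fun i => X i ω) n) atTop (𝓝 (populationCov μ)) :=
    tendsto_pi_nhds.2 fun a => tendsto_pi_nhds.2 fun b => hω a b
  have h2 := ((continuous_norm_sub_matrix (populationCov μ)).tendsto _).comp h1
  rw [sub_self, norm_zero] at h2
  exact h2

/-- The products `⟨u_{k+i}, x⟩ ⟨u_j, x⟩` as a vector. -/
def crossVector (hkd : k ≤ d) (u : OrthonormalBasis (Fin d) ℝ (EuclideanSpace ℝ (Fin d)))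
    (x : EuclideanSpace ℝ (Fin d)) : EuclideanSpace ℝ (Fin (d - k) × Fin k) :=
  WithLp.toLp 2 fun p => inner ℝ (u (tailIdx hkd p.1)) x * inner ℝ (u (headIdx hkd p.2)) x

theorem crossVector_apply (hkd : k ≤ d)
    (u : OrthonormalBasis (Fin d) ℝ (EuclideanSpace ℝ (Fin d)))
    (x : EuclideanSpace ℝ (Fin d)) (p : Fin (d - k) × Fin k) : crossVector hkd u x p =
      inner ℝ (u (tailIdx hkd p.1)) x * inner ℝ (u (headIdx hkd p.2)) x := rfl

theorem measurable_crossVector (hkd : k ≤ d)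
    (u : OrthonormalBasis (Fin d) ℝ (EuclideanSpace ℝ (Fin d))) :
    Measurable (crossVector hkd u) := by
  unfold crossVector
  fun_prop

theorem crossVector_eq_sum (hkd : k ≤ d)
    (u : OrthonormalBasis (Fin d) ℝ (EuclideanSpace ℝ (Fin d)))
    (x : EuclideanSpace ℝ (Fin d)) (p : Fin (d - k) × Fin k) : crossVector hkd u x p =
      ∑ a, ∑ b, u (tailIdx hkd p.1) a * u (headIdx hkd p.2) b * (x a * x b) := by
  rw [crossVector_apply]
  simp only [PiLp.inner_apply, RCLike.inner_apply, conj_trivial, Finset.sum_mul_sum]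
  exact Finset.sum_congr rfl fun a _ => Finset.sum_congr rfl fun b _ => by ring

theorem conj_frames_apply (hkd : k ≤ d)
    (u : OrthonormalBasis (Fin d) ℝ (EuclideanSpace ℝ (Fin d))) (B : Matrix (Fin d) (Fin d) ℝ)
    (i : Fin (d - k)) (j : Fin k) :
    ((trailingFrame hkd u).1ᵀ * B * (leadingFrame hkd u).1) i j =
      ∑ a, ∑ b, u (tailIdx hkd i) a * u (headIdx hkd j) b * B a b := by
  simp only [Matrix.mul_apply, Finset.sum_mul]
  rw [Finset.sum_comm]
  refine Finset.sum_congr rfl fun a _ => Finset.sum_congr rfl fun b _ => ?_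
  change u (tailIdx hkd i) a * B a b * u (headIdx hkd j) b = _
  ring

/-- The mean is an entry of Nᵀ Σ U, which vanishes because Σ maps the span of the leading frame into
itself. -/
theorem integral_crossVector (hkd : k ≤ d) (hmom : Integrable (fun x => ‖x‖ ^ 2) μ)
    {u : OrthonormalBasis (Fin d) ℝ (EuclideanSpace ℝ (Fin d))} {lam : Fin d → ℝ}
    (hu : IsOrderedEigenbasis (populationCov μ) u lam) (p : Fin (d - k) × Fin k) :
    ∫ x, crossVector hkd u x p ∂μ = 0 := by
  have h0 : (trailingFrame hkd u).1ᵀ * populationCov μ * (leadingFrame hkd u).1 = 0 := by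
    have e : populationCov μ * (leadingFrame hkd u).1 = _ := hu.mul_frame _
    rw [Matrix.mul_assoc, e, ← Matrix.mul_assoc]
    have := (isSplit_frames hkd u).cross'
    rw [leadingFrame] at this
    rw [this, Matrix.zero_mul]
  have h1 := conj_frames_apply hkd u (populationCov μ) p.1 p.2
  rw [h0, Matrix.zero_apply] at h1
  rw [h1]
  simp_rw [crossVector_eq_sum]
  have hi : ∀ a b, Integrable (fun x : EuclideanSpace ℝ (Fin d) =>
      u (tailIdx hkd p.1) a * u (headIdx hkd p.2) b * (x a * x b)) μ :=
    fun a b => (integrable_coord_mul hmom a b).const_mul _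
  rw [integral_finsetSum _ fun a _ => integrable_finsetSum _ fun b _ => hi a b]
  refine Finset.sum_congr rfl fun a _ => ?_
  rw [integral_finsetSum _ fun b _ => hi a b]
  refine Finset.sum_congr rfl fun b _ => ?_
  rw [integral_const_mul, populationCov, Matrix.of_apply]

theorem crossVector_mul (hkd : k ≤ d)
    (u : OrthonormalBasis (Fin d) ℝ (EuclideanSpace ℝ (Fin d)))
    (x : EuclideanSpace ℝ (Fin d)) (p q : Fin (d - k) × Fin k) :
    crossVector hkd u x p * crossVector hkd u x q = crossProduct hkd u p.1 p.2 q.1 q.2 x := by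
  rw [crossVector_apply, crossVector_apply, crossProduct]
  ring

/-- The rescaled off-diagonal block of the empirical second-moment matrix. -/
def scaledSum (hkd : k ≤ d) (u : OrthonormalBasis (Fin d) ℝ (EuclideanSpace ℝ (Fin d)))
    (x : ℕ → EuclideanSpace ℝ (Fin d)) (n : ℕ) : EuclideanSpace ℝ (Fin (d - k) × Fin k) :=
  (√(n : ℝ))⁻¹ • ∑ l ∈ Finset.range n, crossVector hkd u (x l)

theorem scaledSum_apply (hkd : k ≤ d)
    (u : OrthonormalBasis (Fin d) ℝ (EuclideanSpace ℝ (Fin d)))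
    (x : ℕ → EuclideanSpace ℝ (Fin d)) (n : ℕ) (i : Fin (d - k)) (j : Fin k) :
    scaledSum hkd u x n (i, j) = √(n : ℝ) *
      ((trailingFrame hkd u).1ᵀ * empiricalCov x n * (leadingFrame hkd u).1) i j := by
  have e : √(n : ℝ) * (n : ℝ)⁻¹ = (√(n : ℝ))⁻¹ := by
    -- At n = 0 both sides vanish by the convention 0⁻¹ = 0.
    rcases eq_or_ne (n : ℝ) 0 with h | h
    · simp [h]
    · have hn : 0 < (n : ℝ) := lt_of_le_of_ne n.cast_nonneg h.symm
      have h1 := Real.mul_self_sqrt hn.le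
      have h2 := (Real.sqrt_pos.2 hn).ne'
      field_simp
      rw [sq, h1]
  rw [conj_frames_apply]
  simp only [scaledSum, PiLp.smul_apply, WithLp.ofLp_sum, Finset.sum_apply, smul_eq_mul,
    crossVector_eq_sum, empiricalCov_apply]
  rw [← e, mul_assoc]
  congr 1
  rw [Finset.sum_comm, Finset.mul_sum]
  refine Finset.sum_congr rfl fun a _ => ?_
  rw [Finset.sum_comm, Finset.mul_sum]
  refine Finset.sum_congr rfl fun b _ => ?_
  rw [← Finset.mul_sum]
  ring

theorem norm_scaledSum (hkd : k ≤ d)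
    (u : OrthonormalBasis (Fin d) ℝ (EuclideanSpace ℝ (Fin d)))
    (x : ℕ → EuclideanSpace ℝ (Fin d)) (n : ℕ) :
    ‖scaledSum hkd u x n‖ = √(n : ℝ) *
      ‖(trailingFrame hkd u).1ᵀ * empiricalCov x n * (leadingFrame hkd u).1‖ := by
  refine (sq_eq_sq₀ (norm_nonneg _) (by positivity)).1 ?_
  rw [mul_pow, frobenius_norm_sq, PiLp.norm_sq_eq_of_L2, Fintype.sum_prod_type, Finset.mul_sum]
  refine Finset.sum_congr rfl fun i _ => ?_
  rw [Finset.mul_sum]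
  refine Finset.sum_congr rfl fun j _ => ?_
  rw [scaledSum_apply, Real.norm_eq_abs, sq_abs, mul_pow]

theorem tendstoInDistribution_scaledSum [IsProbabilityMeasure P] (hkd : k ≤ d) (hindep : iIndepFun X P)
    (hlaw : ∀ i, HasLaw (X i) μ P) (hmom : Integrable (fun x => ‖x‖ ^ 2) μ)
    {u : OrthonormalBasis (Fin d) ℝ (EuclideanSpace ℝ (Fin d))} {lam : Fin d → ℝ}
    (hu : IsOrderedEigenbasis (populationCov μ) u lam)
    (hcross : ∀ (i : Fin (d - k)) (j : Fin k) (s : Fin (d - k)) (t : Fin k),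
      Integrable (crossProduct hkd u i j s t) μ) :
    ∃ S : Matrix (Fin (d - k) × Fin k) (Fin (d - k) × Fin k) ℝ, S.PosSemidef ∧
      (∀ i j s t, S (i, j) (s, t) = crossMoment hkd μ u i j s t) ∧
      TendstoInDistribution (fun (n : ℕ) ω => scaledSum hkd u (fun i => X i ω) n) atTop
        (fun y => y) (fun _ => P) (multivariateGaussian 0 S) := by
  have hm := measurable_crossVector hkd u
  have hm' : ∀ p, Measurable fun x => crossVector hkd u x p := fun p => by
    have : Measurable fun y : EuclideanSpace ℝ (Fin (d - k) × Fin k) => y p := by fun_prop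
    exact this.comp hm
  -- Square integrability is the diagonal case (s, t) = (i, j) of the cross-moment hypothesis.
  have h2 : ∀ p, MemLp (fun ω => crossVector hkd u (X 0 ω) p) 2 P := fun p => by
    refine (memLp_two_iff_integrable_sq
      ((hm' p).comp_aemeasurable (hlaw 0).aemeasurable).aestronglyMeasurable).2 ?_
    refine integrable_comp_of_hasLaw hlaw (f := fun x => crossVector hkd u x p ^ 2)
      ((hm' p).pow_const 2) ?_
    simp_rw [sq, crossVector_mul]
    exact hcross _ _ _ _
  refine ⟨_, posSemidef_secondMoment h2, fun i j s t => ?_,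
    tendstoInDistribution_multivariateGaussian (ξ := fun l ω => crossVector hkd u (X l ω))
      (hindep.comp _ fun _ => hm) (fun l => (identDistrib_of_hasLaw hlaw l).comp hm) h2
      fun p => ?_⟩
  · rw [Matrix.of_apply, integral_comp_of_hasLaw hlaw
      (f := fun x => crossVector hkd u x (i, j) * crossVector hkd u x (s, t))
      ((hm' _).mul (hm' _))]
    simp_rw [crossVector_mul]
    rfl
  · rw [integral_comp_of_hasLaw hlaw (hm' p), integral_crossVector hkd hmom hu]

end Sample

end PCA

namespace PCA

/-! ### The three limit statements. -/

section Main

open scoped Matrix.Norms.Frobenius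

variable {d k : ℕ} {Ω : Type*} [MeasurableSpace Ω] {P : Measure Ω} [IsProbabilityMeasure P]
  {μ : Measure (EuclideanSpace ℝ (Fin d))} {X : ℕ → Ω → EuclideanSpace ℝ (Fin d)}
  {u : OrthonormalBasis (Fin d) ℝ (EuclideanSpace ℝ (Fin d))} {lam : Fin d → ℝ}
  {un : ℕ → Ω → OrthonormalBasis (Fin d) ℝ (EuclideanSpace ℝ (Fin d))}
  {lamn : ℕ → Ω → Fin d → ℝ}

theorem consistency (hk : 1 ≤ k) (hkd : k < d) (hindep : iIndepFun X P)
    (hlaw : ∀ i, HasLaw (X i) μ P) (hmom : Integrable (fun x => ‖x‖ ^ 2) μ)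
    (hu : IsOrderedEigenbasis (populationCov μ) u lam)
    {hk' : k - 1 < d} (hgap : lam ⟨k, hkd⟩ < lam ⟨k - 1, hk'⟩)
    (hun : ∀ n ω, IsOrderedEigenbasis (empiricalCov (fun i => X i ω) n) (un n ω) (lamn n ω))
    {ε : ℝ} (hε : 0 < ε) :
    Tendsto (fun n : ℕ => P {ω | ε < grDist (Grassmannian.mk (leadingFrame hkd.le (un n ω)))
      (Grassmannian.mk (leadingFrame hkd.le u))}) atTop (𝓝 0) := by
  obtain ⟨η, hη, h⟩ := exists_grDist_leadingFrame_le hk hkd hu hgap hε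
  have h1 := tendstoInMeasure_iff_norm.1
    (tendstoInMeasure_norm_empiricalCov_sub hindep hlaw hmom) η hη
  refine tendsto_of_tendsto_of_tendsto_of_le_of_le tendsto_const_nhds h1 (fun _ => zero_le) ?_
  intro n
  refine measure_mono fun ω hω => ?_
  simp only [Set.mem_ofPred_eq, sub_zero, Real.norm_eq_abs, abs_norm]
  by_contra hlt
  exact absurd (h _ _ _ (hun n ω) (not_le.1 hlt)) (not_le.2 hω)

theorem gap_pos (hkd : k < d) {A : Matrix (Fin d) (Fin d) ℝ}
    (hu : IsOrderedEigenbasis A u lam) {hk' : k - 1 < d} (hgap : lam ⟨k, hkd⟩ < lam ⟨k - 1, hk'⟩)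
    (i : Fin (d - k)) (j : Fin k) : 0 < gap hkd.le lam i j :=
  sub_pos.2 ((hu.tail_le hkd i).trans_lt (hgap.trans_le (hu.le_head hkd.le hk' j)))

theorem asymptotic_normality (hk : 1 ≤ k) (hkd : k < d) (hindep : iIndepFun X P)
    (hlaw : ∀ i, HasLaw (X i) μ P) (hmom : Integrable (fun x => ‖x‖ ^ 2) μ)
    (hu : IsOrderedEigenbasis (populationCov μ) u lam)
    {hk' : k - 1 < d} (hgap : lam ⟨k, hkd⟩ < lam ⟨k - 1, hk'⟩)
    (hcross : ∀ (i : Fin (d - k)) (j : Fin k) (s : Fin (d - k)) (t : Fin k),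
      Integrable (crossProduct hkd.le u i j s t) μ)
    (hun : ∀ n ω, IsOrderedEigenbasis (empiricalCov (fun i => X i ω) n) (un n ω) (lamn n ω))
    (hmeas : ∀ n, AEMeasurable
      (fun ω => Grassmannian.mk (leadingFrame hkd.le (un n ω))) P) :
    ∃ ν : ProbabilityMeasure (Matrix (Fin (d - k)) (Fin k) ℝ),
      IsCenteredGaussianMatrix (ν : Measure (Matrix (Fin (d - k)) (Fin k) ℝ))
        (fun i j s t => crossMoment hkd.le μ u i j s t /
          (gap hkd.le lam i j * gap hkd.le lam s t)) ∧
      ∀ D : ℕ → Ω → Matrix (Fin d) (Fin k) ℝ, (∀ n, AEMeasurable (D n) P) →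
        TendstoInDistribution
          (fun (n : ℕ) ω => √(n : ℝ) • liftLog (leadingFrame hkd.le u)
            (Grassmannian.mk (leadingFrame hkd.le (un n ω))) (D n ω))
          atTop
          (fun G : Matrix (Fin (d - k)) (Fin k) ℝ => (trailingFrame hkd.le u).1 * G)
          (fun _ => P) (ν : Measure (Matrix (Fin (d - k)) (Fin k) ℝ)) := by
  obtain ⟨S, hS, hSΛ, hclt⟩ := tendstoInDistribution_scaledSum hkd.le hindep hlaw hmom hu hcross
  obtain ⟨c, ε₀, _, hε₀, hexp⟩ := exists_liftLog_risk_expansion hk hkd hmom hu hgap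
  set w : Fin (d - k) → Fin k → ℝ := fun i j => (gap hkd.le lam i j)⁻¹ with hw
  have hφ : Measurable (weightedMatrix w) := (weightedMatrix w).continuous.measurable
  have hprob : IsProbabilityMeasure ((multivariateGaussian 0 S).map (weightedMatrix w)) :=
    Measure.isProbabilityMeasure_map hφ.aemeasurable
  set ν : ProbabilityMeasure (Matrix (Fin (d - k)) (Fin k) ℝ) := ⟨_, hprob⟩ with hν
  refine ⟨ν, ?_, fun D hD => ?_⟩
  · have h := isCenteredGaussianMatrix_map w hS
    refine ⟨h.isGaussian, h.mean_eq_zero, fun i j s t => (h.moment_eq i j s t).trans ?_⟩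
    rw [hSΛ, hw, div_eq_inv_mul, mul_inv]
  have hN : Continuous fun G : Matrix (Fin (d - k)) (Fin k) ℝ => (trailingFrame hkd.le u).1 * G :=
    continuous_const.matrix_mul continuous_id
  have h1 := hclt.continuous_comp (hN.comp (weightedMatrix w).continuous)
  have h2 : TendstoInDistribution _ atTop
      (fun G : Matrix (Fin (d - k)) (Fin k) ℝ => (trailingFrame hkd.le u).1 * G) (fun _ => P)
      (ν : Measure (Matrix (Fin (d - k)) (Fin k) ℝ)) :=
    tendstoInDistribution_of_map_eq h1 hN.measurable.aemeasurable
      (Measure.map_map hN.measurable hφ).symm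
  have hsmul : ∀ r : ℝ, Continuous fun M : Matrix (Fin d) (Fin k) ℝ => r • M := fun r =>
    continuous_id.const_smul r
  refine tendstoInDistribution_matrix_of_tendsto_measure_norm_sub h2 (fun n =>
    (hsmul _).measurable.comp_aemeasurable (aemeasurable_liftLog hkd.le _ (hmeas n) (hD n))) ?_
  intro ε hε
  have hlln := tendstoInMeasure_norm_empiricalCov_sub hindep hlaw hmom
  -- Power 1: √n times the error is c ‖√n C‖ ‖Σ_n - Σ‖, a tight factor times one vanishing in
  -- probability.
  refine tendsto_measure_of_forall_imp hε₀ hlln ?_ (tendsto_measure_const_mul_norm_pow_mul hclt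
    hlln (fun n => aemeasurable_norm_empiricalCov_sub hlaw n _) c 1 hε)
  intro n ω he
  rw [abs_norm] at he
  have h3 := (hexp _ _ _ (hun n ω) he _ rfl).1 (D n ω)
  set B := empiricalCov (fun i => X i ω) n
  have e : weightedMatrix w (scaledSum hkd.le u (fun i => X i ω) n) = √(n : ℝ) •
      Matrix.of fun i j => ((trailingFrame hkd.le u).1ᵀ * B * (leadingFrame hkd.le u).1) i j /
        gap hkd.le lam i j := by
    ext i j
    rw [weightedMatrix_apply, scaledSum_apply, Matrix.smul_apply, Matrix.of_apply, smul_eq_mul]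
    simp only [hw, B]
    ring
  simp only [Function.comp_apply]
  rw [e, Matrix.mul_smul, ← smul_sub, norm_smul, Real.norm_of_nonneg (Real.sqrt_nonneg _), pow_one,
    norm_scaledSum]
  calc _ ≤ √(n : ℝ) * _ := mul_le_mul_of_nonneg_left h3 (Real.sqrt_nonneg _)
    _ = _ := by ring

theorem excess_risk (hk : 1 ≤ k) (hkd : k < d) (hindep : iIndepFun X P)
    (hlaw : ∀ i, HasLaw (X i) μ P) (hmom : Integrable (fun x => ‖x‖ ^ 2) μ)
    (hu : IsOrderedEigenbasis (populationCov μ) u lam)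
    {hk' : k - 1 < d} (hgap : lam ⟨k, hkd⟩ < lam ⟨k - 1, hk'⟩)
    (hcross : ∀ (i : Fin (d - k)) (j : Fin k) (s : Fin (d - k)) (t : Fin k),
      Integrable (crossProduct hkd.le u i j s t) μ)
    (hun : ∀ n ω, IsOrderedEigenbasis (empiricalCov (fun i => X i ω) n) (un n ω) (lamn n ω))
    (hmeas : ∀ n, AEMeasurable
      (fun ω => Grassmannian.mk (leadingFrame hkd.le (un n ω))) P) :
    ∃ ν : ProbabilityMeasure (Matrix (Fin (d - k)) (Fin k) ℝ),
      IsCenteredGaussianMatrix (ν : Measure (Matrix (Fin (d - k)) (Fin k) ℝ))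
        (fun i j s t => crossMoment hkd.le μ u i j s t /
          √(gap hkd.le lam i j * gap hkd.le lam s t)) ∧
      TendstoInDistribution
        (fun (n : ℕ) ω => (n : ℝ) *
          (risk μ (Grassmannian.mk (leadingFrame hkd.le (un n ω))) -
            risk μ (Grassmannian.mk (leadingFrame hkd.le u))))
        atTop
        (fun H : Matrix (Fin (d - k)) (Fin k) ℝ => (1 / 2 : ℝ) * frobeniusSq H)
        (fun _ => P) (ν : Measure (Matrix (Fin (d - k)) (Fin k) ℝ)) := by
  obtain ⟨S, hS, hSΛ, hclt⟩ := tendstoInDistribution_scaledSum hkd.le hindep hlaw hmom hu hcross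
  obtain ⟨c, ε₀, _, hε₀, hexp⟩ := exists_liftLog_risk_expansion hk hkd hmom hu hgap
  -- Squared, these weights turn n C² into n C²/δ, so half the squared Frobenius norm is the leading
  -- term of the excess risk.
  set w : Fin (d - k) → Fin k → ℝ := fun i j => (√(gap hkd.le lam i j))⁻¹ with hw
  have hφ : Measurable (weightedMatrix w) := (weightedMatrix w).continuous.measurable
  have hprob : IsProbabilityMeasure ((multivariateGaussian 0 S).map (weightedMatrix w)) :=
    Measure.isProbabilityMeasure_map hφ.aemeasurable
  set ν : ProbabilityMeasure (Matrix (Fin (d - k)) (Fin k) ℝ) := ⟨_, hprob⟩ with hν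
  refine ⟨ν, ?_, ?_⟩
  · have h := isCenteredGaussianMatrix_map w hS
    refine ⟨h.isGaussian, h.mean_eq_zero, fun i j s t => (h.moment_eq i j s t).trans ?_⟩
    rw [hSΛ, hw, div_eq_inv_mul, Real.sqrt_mul (gap_pos hkd hu hgap i j).le, mul_inv]
  have hF : Continuous fun H : Matrix (Fin (d - k)) (Fin k) ℝ => (1 / 2 : ℝ) * frobeniusSq H := by
    refine continuous_const.mul (continuous_finsetSum _ fun i _ =>
      continuous_finsetSum _ fun j _ => ?_)
    exact (continuous_id.matrix_elem i j).pow 2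
  have h1 := hclt.continuous_comp (hF.comp (weightedMatrix w).continuous)
  have h2 : TendstoInDistribution _ atTop
      (fun H : Matrix (Fin (d - k)) (Fin k) ℝ => (1 / 2 : ℝ) * frobeniusSq H) (fun _ => P)
      (ν : Measure (Matrix (Fin (d - k)) (Fin k) ℝ)) :=
    tendstoInDistribution_of_map_eq h1 hF.measurable.aemeasurable
      (Measure.map_map hF.measurable hφ).symm
  refine tendstoInDistribution_real_of_tendsto_measure h2 (fun n =>
    (((measurable_risk hmom).comp_aemeasurable (hmeas n)).sub_const _).const_mul _) ?_
  intro ε hε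
  have hlln := tendstoInMeasure_norm_empiricalCov_sub hindep hlaw hmom
  -- Power 2: n times the error is c ‖√n C‖² ‖Σ_n - Σ‖.
  refine tendsto_measure_of_forall_imp hε₀ hlln ?_ (tendsto_measure_const_mul_norm_pow_mul hclt
    hlln (fun n => aemeasurable_norm_empiricalCov_sub hlaw n _) c 2 hε)
  intro n ω he
  rw [abs_norm] at he
  have h3 := (hexp _ _ _ (hun n ω) he _ rfl).2
  set B := empiricalCov (fun i => X i ω) n
  have hn : √(n : ℝ) ^ 2 = n := Real.sq_sqrt n.cast_nonneg
  have e : (1 / 2 : ℝ) * frobeniusSq (weightedMatrix w (scaledSum hkd.le u (fun i => X i ω) n)) =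
      n * (1 / 2 * ∑ i, ∑ j, ((trailingFrame hkd.le u).1ᵀ * B * (leadingFrame hkd.le u).1) i j ^ 2 /
        gap hkd.le lam i j) := by
    rw [mul_left_comm]
    congr 1
    rw [frobeniusSq, Finset.mul_sum]
    refine Finset.sum_congr rfl fun i _ => ?_
    rw [Finset.mul_sum]
    refine Finset.sum_congr rfl fun j _ => ?_
    rw [weightedMatrix_apply, scaledSum_apply, mul_pow, mul_pow, hn, inv_pow,
      Real.sq_sqrt (gap_pos hkd hu hgap i j).le]
    ring
  simp only [Function.comp_apply]
  rw [e, ← mul_sub, abs_mul, Nat.abs_cast, norm_scaledSum, mul_pow, hn]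
  calc _ ≤ (n : ℝ) * _ := mul_le_mul_of_nonneg_left h3 n.cast_nonneg
    _ = _ := by ring

end Main

end PCA

end

theorem theorem1 {d k : ℕ} (hk : 1 ≤ k) (hkd : k < d)
    -- i.i.d. samples in `ℝ^d` with common law `μ`, and `E‖X‖² < ∞`
    {Ω : Type*} [MeasurableSpace Ω] (P : Measure Ω) [IsProbabilityMeasure P]
    (μ : Measure (EuclideanSpace ℝ (Fin d))) [IsProbabilityMeasure μ]
    (X : ℕ → Ω → EuclideanSpace ℝ (Fin d))
    (hindep : iIndepFun X P) (hlaw : ∀ i, HasLaw (X i) μ P)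
    (hmom : Integrable (fun x => ‖x‖ ^ 2) μ)
    -- ordered eigenbasis of the population covariance, with eigengap and cross moments
    (u : OrthonormalBasis (Fin d) ℝ (EuclideanSpace ℝ (Fin d))) (lam : Fin d → ℝ)
    (hu : PCA.IsOrderedEigenbasis (PCA.populationCov μ) u lam)
    (hgap : lam ⟨k, hkd⟩ < lam ⟨k - 1, by omega⟩)
    (hcross : ∀ (i : Fin (d - k)) (j : Fin k) (s : Fin (d - k)) (t : Fin k),
      Integrable (PCA.crossProduct hkd.le u i j s t) μ)
    -- ordered eigenbases of the empirical covariances, ties broken arbitrarily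
    (un : ℕ → Ω → OrthonormalBasis (Fin d) ℝ (EuclideanSpace ℝ (Fin d)))
    (lamn : ℕ → Ω → Fin d → ℝ)
    (hun : ∀ n ω, PCA.IsOrderedEigenbasis (PCA.empiricalCov (fun i => X i ω) n)
      (un n ω) (lamn n ω))
    -- `[U_n]` is a random element of the Grassmannian
    (hmeas : ∀ n, AEMeasurable
      (fun ω => PCA.Grassmannian.mk (PCA.leadingFrame hkd.le (un n ω))) P) :
    -- consistency
    (∀ ε : ℝ, 0 < ε →
      Tendsto (fun n : ℕ => P {ω | ε < PCA.grDist
          (PCA.Grassmannian.mk (PCA.leadingFrame hkd.le (un n ω)))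
          (PCA.Grassmannian.mk (PCA.leadingFrame hkd.le u))})
        atTop (𝓝 0)) ∧
    -- asymptotic normality
    (∃ ν : ProbabilityMeasure (Matrix (Fin (d - k)) (Fin k) ℝ),
      PCA.IsCenteredGaussianMatrix (ν : Measure (Matrix (Fin (d - k)) (Fin k) ℝ))
        (fun i j s t => PCA.crossMoment hkd.le μ u i j s t /
          (PCA.gap hkd.le lam i j * PCA.gap hkd.le lam s t)) ∧
      ∀ D : ℕ → Ω → Matrix (Fin d) (Fin k) ℝ, (∀ n, AEMeasurable (D n) P) →
        TendstoInDistribution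
          (fun (n : ℕ) ω => √(n : ℝ) • PCA.liftLog (PCA.leadingFrame hkd.le u)
            (PCA.Grassmannian.mk (PCA.leadingFrame hkd.le (un n ω))) (D n ω))
          atTop
          (fun G : Matrix (Fin (d - k)) (Fin k) ℝ => (PCA.trailingFrame hkd.le u).1 * G)
          (fun _ => P) (ν : Measure (Matrix (Fin (d - k)) (Fin k) ℝ))) ∧
    -- excess risk
    (∃ ν : ProbabilityMeasure (Matrix (Fin (d - k)) (Fin k) ℝ),
      PCA.IsCenteredGaussianMatrix (ν : Measure (Matrix (Fin (d - k)) (Fin k) ℝ))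
        (fun i j s t => PCA.crossMoment hkd.le μ u i j s t /
          √(PCA.gap hkd.le lam i j * PCA.gap hkd.le lam s t)) ∧
      TendstoInDistribution
        (fun (n : ℕ) ω => (n : ℝ) *
          (PCA.risk μ (PCA.Grassmannian.mk (PCA.leadingFrame hkd.le (un n ω))) -
            PCA.risk μ (PCA.Grassmannian.mk (PCA.leadingFrame hkd.le u))))
        atTop
        (fun H : Matrix (Fin (d - k)) (Fin k) ℝ => (1 / 2 : ℝ) * PCA.frobeniusSq H)
        (fun _ => P) (ν : Measure (Matrix (Fin (d - k)) (Fin k) ℝ))) :=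
  ⟨fun _ hε => PCA.consistency hk hkd hindep hlaw hmom hu hgap hun hε,
    PCA.asymptotic_normality hk hkd hindep hlaw hmom hu hgap hcross hun hmeas,
    PCA.excess_risk hk hkd hindep hlaw hmom hu hgap hcross hun hmeas⟩
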